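/- Let $m\ge 0$ and $n\ge 1$ be integers and $T>0$. Let $S,N\in \mathrm O(m)$ satisfy $S^n=I_m$ and $N^2=(NS)^2=I_m$. Let $L=L(t,q,v):\mathbb R\times\mathbb R^m\times\mathbb R^m\to\mathbb R$ be a Lagrangian which is $C^2$ on $[0,T]\times\mathbb R^m\times\mathbb R^m$, satisfies the Legendre condition that $\partial_v^2L(t,q,v)$ is positive definite for all $t\in[0,T]$ and $q,v\in\mathbb R^m$, and is dihedrally invariant: $$L(t,q,v)=L(t-\tfrac Tn,Sq,Sv),\qquad L(t,q,v)=L(\tfrac Tn-t,Nq,-Nv)\qquad\text{for all } t\in\mathbb R,\ q,v\in\mathbb R^m$$ (so $L$ is $T$-periodic in $t$, and the action $\mathscr S_L(x)=\int_0^TL(t,x,\dot x)\,dt$ on $T$-periodic loops is invariant under $x\mapsto Sx(\cdot+T/n)$ and $x\mapsto Nx(T/n-\cdot)$). Let $x:\mathbb R\to\mathbb R^m$ be a $C^1$, $T$-periodic critical point of $\mathscr S_L$ (the first variation vanishes along every $C^1$ $T$-periodic variation) which is dihedrally symmetric: $Sx(t+T/n)=x(t)$ and $Nx(T/n-t)=x(t)$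 for all $t$. Put $$P=\partial^2_vL,\qquad Q=\Big(\frac{\partial^2L}{\partial v_i\,\partial q_j}\Big)_{ij},\qquad R=\partial_q^2L,\qquad\text{evaluated at }(t,x(t),\dot x(t)),$$ and let $$\mathcal A u=-\frac{d}{dt}\big(P\dot u+Qu\big)+Q^{\mathsf T}\dot u+Ru .$$ Assume that $\mathcal A$ is defined and positive definite on the Neumann space $$E^2\big(\tfrac T{2n}\big)=\big\{u\in W^{2,2}([0,\tfrac T{2n}],\mathbb C^m):\ \dot u(0)=\dot u(\tfrac T{2n})=0\big\},$$ that is, for every $u\in E^2(\frac T{2n})$ one has $P\dot u+Qu\in W^{1,2}$ (which is automatic when $P$ and $Q$ are $C^1$), so that $\mathcal Au\in L^2$, and if $u\ne0$ the Hermitian product $\langle\mathcal Au,u\rangle_{L^2([0,T/(2n)],\mathbb C^m)}$ is real and strictly positive. Let $\gamma:[0,T]\to\mathbb R^{2m\times 2m}$ be the fundamental solution of the associated linear Hamiltonian system, $\dot\gamma=JB(t)\gamma$, $\gamma(0)=I_{2m}$, where $$J=\begin{bmatrix}0&-I\\ I&0\end{bmatrix},\qquad B=\begin{bmatrix}P^{-1}&-P^{-1}Q\\-Q^{\mathsf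 T}P^{-1}&Q^{\mathsf T}P^{-1}Q-R\end{bmatrix}.$$ Then the monodromy matrix $M_T=\gamma(T)$ has no eigenvalue on the unit circle $\{\omega\in\mathbb C:|\omega|=1\}$; that is, $x$ is hyperbolic. -/

import Mathlib

open MeasureTheory Set

noncomputable section

/-- The partial derivative `∂L/∂q_i` of a time-dependent Lagrangian `L t q v`. -/
def partialQ {m : ℕ} (L : ℝ → (Fin m → ℝ) → (Fin m → ℝ) → ℝ)
    (t : ℝ) (q v : Fin m → ℝ) (i : Fin m) : ℝ :=
  fderiv ℝ (fun y => L t y v) q (Pi.single i 1)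

/-- The partial derivative `∂L/∂v_i` of a time-dependent Lagrangian `L t q v`. -/
def partialV {m : ℕ} (L : ℝ → (Fin m → ℝ) → (Fin m → ℝ) → ℝ)
    (t : ℝ) (q v : Fin m → ℝ) (i : Fin m) : ℝ :=
  fderiv ℝ (fun y => L t q y) v (Pi.single i 1)

/-- The matrix `∂²L/∂v_i∂v_j`. -/
def hessVV {m : ℕ} (L : ℝ → (Fin m → ℝ) → (Fin m → ℝ) → ℝ)
    (t : ℝ) (q v : Fin m → ℝ) : Matrix (Fin m) (Fin m) ℝ :=
  Matrix.of fun i j => fderiv ℝ (fun y => partialV L t q y i) v (Pi.single j 1)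

/-- The matrix `∂²L/∂v_i∂q_j` (row index: velocity, column index: position). -/
def hessVQ {m : ℕ} (L : ℝ → (Fin m → ℝ) → (Fin m → ℝ) → ℝ)
    (t : ℝ) (q v : Fin m → ℝ) : Matrix (Fin m) (Fin m) ℝ :=
  Matrix.of fun i j => fderiv ℝ (fun y => partialV L t y v i) q (Pi.single j 1)

/-- The matrix `∂²L/∂q_i∂q_j`. -/
def hessQQ {m : ℕ} (L : ℝ → (Fin m → ℝ) → (Fin m → ℝ) → ℝ)
    (t : ℝ) (q v : Fin m → ℝ) : Matrix (Fin m) (Fin m) ℝ :=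
  Matrix.of fun i j => fderiv ℝ (fun y => partialQ L t y v i) q (Pi.single j 1)

/-- The Legendre convexity condition: `∂²L/∂v²` is positive definite on `[0,T] × ℝ^m × ℝ^m`. -/
def LegendreConvex {m : ℕ} (L : ℝ → (Fin m → ℝ) → (Fin m → ℝ) → ℝ) (T : ℝ) : Prop :=
  ∀ t ∈ Icc 0 T, ∀ q v w : Fin m → ℝ, w ≠ 0 → 0 < (hessVV L t q v).mulVec w ⬝ᵥ w

/-- The Lagrangian action `∫_0^T L(t, x, x') dt`. -/
def lagrangianAction {m : ℕ} (L : ℝ → (Fin m → ℝ) → (Fin m → ℝ) → ℝ) (T : ℝ)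
    (x : ℝ → Fin m → ℝ) : ℝ :=
  ∫ t in (0 : ℝ)..T, L t (x t) (deriv x t)

/-- `x` is a `C¹` `T`-periodic loop at which the first variation of the action vanishes along
every `C¹` `T`-periodic variation. -/
def IsCriticalLoop {m : ℕ} (L : ℝ → (Fin m → ℝ) → (Fin m → ℝ) → ℝ) (T : ℝ)
    (x : ℝ → Fin m → ℝ) : Prop :=
  ContDiff ℝ 1 x ∧ Function.Periodic x T ∧
    ∀ η : ℝ → Fin m → ℝ, ContDiff ℝ 1 η → Function.Periodic η T →
      HasDerivAt (fun s : ℝ => lagrangianAction L T (fun t => x t + s • η t)) 0 0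

/-- The coefficient `P(t) = ∂²L/∂v² (t, x(t), x'(t))`. -/
def coeffP {m : ℕ} (L : ℝ → (Fin m → ℝ) → (Fin m → ℝ) → ℝ) (x : ℝ → Fin m → ℝ) (t : ℝ) :
    Matrix (Fin m) (Fin m) ℝ :=
  hessVV L t (x t) (deriv x t)

/-- The coefficient `Q(t) = ∂²L/∂v∂q (t, x(t), x'(t))`. -/
def coeffQ {m : ℕ} (L : ℝ → (Fin m → ℝ) → (Fin m → ℝ) → ℝ) (x : ℝ → Fin m → ℝ) (t : ℝ) :
    Matrix (Fin m) (Fin m) ℝ :=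
  hessVQ L t (x t) (deriv x t)

/-- The coefficient `R(t) = ∂²L/∂q² (t, x(t), x'(t))`. -/
def coeffR {m : ℕ} (L : ℝ → (Fin m → ℝ) → (Fin m → ℝ) → ℝ) (x : ℝ → Fin m → ℝ) (t : ℝ) :
    Matrix (Fin m) (Fin m) ℝ :=
  hessQQ L t (x t) (deriv x t)

/-- A real matrix regarded as a complex one. -/
def cMat {ι : Type*} (A : Matrix ι ι ℝ) : Matrix ι ι ℂ :=
  A.map Complex.ofReal

/-- `u` (its continuous representative) lies in `W^{1,2}([0,a], ℂ^m)` and `g` is its derivative: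
`g` is in `L²` and `u` is the primitive of `g` on `[0,a]`. -/
def HasSobolevDeriv {m : ℕ} (a : ℝ) (u g : ℝ → Fin m → ℂ) : Prop :=
  MemLp g 2 (volume.restrict (Icc 0 a)) ∧ ∀ t ∈ Icc 0 a, u t = u 0 + ∫ s in (0 : ℝ)..t, g s

/-- `u ∈ W^{2,2}([0,a], ℂ^m)` with the Neumann conditions `u'(0) = u'(a) = 0`
(here `u₁` is the continuous representative of `u'` and `u₂` is `u''`). -/
def MemNeumann {m : ℕ} (a : ℝ) (u : ℝ → Fin m → ℂ) : Prop :=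
  ∃ u₁ u₂ : ℝ → Fin m → ℂ,
    HasSobolevDeriv a u u₁ ∧ HasSobolevDeriv a u₁ u₂ ∧ u₁ 0 = 0 ∧ u₁ a = 0

/-- `f = - (P u' + Q u)' + Qᵀ u' + R u` on `[0,a]`, where `u` and `P u' + Q u` are in `W^{1,2}`
and `w` is the derivative of the latter. -/
def IsSturmImage {m : ℕ} (P Q R : ℝ → Matrix (Fin m) (Fin m) ℝ) (a : ℝ)
    (u f : ℝ → Fin m → ℂ) : Prop :=
  ∃ u₁ w : ℝ → Fin m → ℂ, HasSobolevDeriv a u u₁ ∧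
    HasSobolevDeriv a (fun t => (cMat (P t)).mulVec (u₁ t) + (cMat (Q t)).mulVec (u t)) w ∧
    ∀ t ∈ Icc 0 a, f t =
      -w t + (cMat (Q t).transpose).mulVec (u₁ t) + (cMat (R t)).mulVec (u t)

/-- The Hermitian `L²([0,a], ℂ^m)` product, linear in the first argument. -/
def l2Inner {m : ℕ} (a : ℝ) (f u : ℝ → Fin m → ℂ) : ℂ :=
  ∫ t in (0 : ℝ)..a, f t ⬝ᵥ star (u t)

/-- The Sturm operator `A u = - (P u' + Q u)' + Qᵀ u' + R u` is (defined and) positive definite on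
the Neumann space over `[0,a]`: for each `u` in that space `A u` exists in `L²`, and `⟨A u, u⟩` is
real and positive if `u ≠ 0`. -/
def SturmPosDefNeumann {m : ℕ} (P Q R : ℝ → Matrix (Fin m) (Fin m) ℝ) (a : ℝ) : Prop :=
  ∀ u : ℝ → Fin m → ℂ, MemNeumann a u →
    ∃ f : ℝ → Fin m → ℂ, IsSturmImage P Q R a u f ∧
      ((∃ t ∈ Icc 0 a, u t ≠ 0) → (l2Inner a f u).im = 0 ∧ 0 < (l2Inner a f u).re)

/-- The coefficient matrix `B` of the linear Hamiltonian system `z' = J B(t) z`, `z = (p, q)`,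
obtained from the Sturm equation by the Legendre transform. -/
def hamB {m : ℕ} (P Q R : Matrix (Fin m) (Fin m) ℝ) : Matrix (Fin m ⊕ Fin m) (Fin m ⊕ Fin m) ℝ :=
  Matrix.fromBlocks P⁻¹ (-(P⁻¹ * Q)) (-(Q.transpose * P⁻¹)) (Q.transpose * P⁻¹ * Q - R)

/-- `J = [[0, -I], [I, 0]]`. -/
def stdJ (m : ℕ) : Matrix (Fin m ⊕ Fin m) (Fin m ⊕ Fin m) ℝ :=
  Matrix.fromBlocks 0 (-1) 1 0

/-- `γ` is the fundamental solution on `[0,T]`: `γ' = J B(t) γ`, `γ(0) = I`. -/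
def IsFundamentalSolution {m : ℕ} (P Q R : ℝ → Matrix (Fin m) (Fin m) ℝ) (T : ℝ)
    (γ : ℝ → Matrix (Fin m ⊕ Fin m) (Fin m ⊕ Fin m) ℝ) : Prop :=
  γ 0 = 1 ∧ ∀ t ∈ Icc 0 T,
    HasDerivWithinAt γ (stdJ m * hamB (P t) (Q t) (R t) * γ t) (Icc 0 T) t

/-- A real matrix is hyperbolic if it has no complex eigenvalue on the unit circle. -/
def IsHyperbolicMatrix {ι : Type*} [Fintype ι] [DecidableEq ι] (M : Matrix ι ι ℝ) : Prop :=
  ∀ ω : ℂ, ‖ω‖ = 1 → ¬ Module.End.HasEigenvalue (Matrix.toLin' (cMat M)) ω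

end

/-! Write `a = T/(2n)`. Suppose `ω` with `|ω| = 1` is an eigenvalue of the monodromy matrix. Its
eigenvector starts a solution `(p, u)` of the linear system with `u(T) = ω u(0)` and `p(T) = ω
p(0)`. The quantity to follow is `H(t) = Re (P u' · ū)`. Integrating `⟨A v, v⟩` by parts for a
Neumann `v` gives a sesquilinear form, `sturmForm`: an integral of first derivatives minus the
boundary term of `Q v · v̄`. On a solution its value is the increment of `P u' · ū` over `[0,a]`.

Neumann conditions are natural: the form sees `v'` only under the integral, so approximating `v'` by
functions vanishing at `0` and `a` shows that it is nonnegative on all `C¹` functions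
(`SturmPosDefNeumann.form_nonneg`). The dihedral group tiles `[0,T]` by `2n` copies of `[0,a]` and
carries solutions to solutions, whence `H(ka) ≤ H((k+1)a)` for every `k < 2n`
(`IsSturmSolution.boundary_mono`). Since `H = Re ((p - Q u) · ū)`, `Q(T) = Q(0)` and `|ω| = 1`, also
`H(T) = H(0)`. Hence `H` is constant along the points `ka`, and the form vanishes at `u` on `[0,a]`.

A null vector of a nonnegative Hermitian form is orthogonal to everything. Testing against `w` with
`w(0) = -P u'(0)` and `w(a) = P u'(a)` gives `P u' = 0` at both ends
(`IsSturmSolution.boundary_nonneg`), so `u` satisfies the Neumann conditions. Strict positivity then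
forces `u = 0` on `[0,a]`, hence `p(0) = 0`, and the eigenvector is zero.

The delicate point is `u ∈ W^{2,2}`: `L` is `C²` and `x` is `C¹`, so `P` and `Q` are a priori only
continuous. What regularity they have must be extracted from the assumption that `A` is defined on
the Neumann space (`SturmPosDefNeumann.l2Dominated_of_P`). The same assumption, through the reality
of `⟨A v, v⟩`, makes `Q` symmetric at `0` and `a`, which the Hermitian argument needs. -/

/-- The increments of `g` on `[0,a]` are dominated by the integral of a nonnegative `L²` function. -/
def L2Dominated {E : Type*} [NormedAddCommGroup E] (a : ℝ) (g : ℝ → E) : Prop :=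
  ∃ k : ℝ → ℝ, (∀ t, 0 ≤ k t) ∧ MemLp k 2 (volume.restrict (Icc 0 a)) ∧
    ∀ s ∈ Icc 0 a, ∀ t ∈ Icc 0 a, s ≤ t → ‖g t - g s‖ ≤ ∫ r in s..t, k r

/-! ### `W^{1,2}` functions on an interval, via domination of increments. -/

section Sobolev

variable {E : Type*} [NormedAddCommGroup E] {a : ℝ}

lemma MemLp.intervalIntegrable_of_mem_Icc {k : ℝ → E}
    (hk : MemLp k 2 (volume.restrict (Icc 0 a))) {s t : ℝ} (hs : s ∈ Icc 0 a) (ht : t ∈ Icc 0 a) :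
    IntervalIntegrable k volume s t := by
  have h1 : IntegrableOn k (Icc 0 a) volume := hk.integrable (by norm_num)
  rw [intervalIntegrable_iff]
  refine h1.mono_set (uIoc_subset_uIcc.trans ?_)
  exact uIcc_subset_Icc hs ht

/-- Increments of `g` are bounded by those of the primitive of `k`, which is absolutely continuous,
so the same `δ` serves for `g`. -/
lemma absolutelyContinuousOnInterval_of_norm_sub_le (ha : 0 ≤ a) {g : ℝ → E} {k : ℝ → ℝ}
    (hk : IntervalIntegrable k volume 0 a)
    (h : ∀ s ∈ Icc 0 a, ∀ t ∈ Icc 0 a, s ≤ t → ‖g t - g s‖ ≤ ∫ r in s..t, k r) :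
    AbsolutelyContinuousOnInterval g 0 a := by
  have hK := hk.absolutelyContinuousOnInterval_intervalIntegral (c := 0) (by simp)
  have key : ∀ s ∈ Icc 0 a, ∀ t ∈ Icc 0 a, dist (g s) (g t) ≤
      dist (∫ r in (0:ℝ)..s, k r) (∫ r in (0:ℝ)..t, k r) := by
    have sub : ∀ s ∈ Icc 0 a, ∀ t ∈ Icc 0 a, IntervalIntegrable k volume s t := by
      intro s hs t ht
      refine hk.mono_set ?_
      rw [uIcc_of_le ha]; exact uIcc_subset_Icc hs ht
    have z : (0:ℝ) ∈ Icc 0 a := ⟨le_rfl, ha⟩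
    have main : ∀ s ∈ Icc 0 a, ∀ t ∈ Icc 0 a, s ≤ t → dist (g s) (g t) ≤
      dist (∫ r in (0:ℝ)..s, k r) (∫ r in (0:ℝ)..t, k r) := by
      intro s hs t ht hst
      rw [dist_comm, dist_eq_norm, dist_comm, dist_eq_norm,
        intervalIntegral.integral_interval_sub_left (sub _ z _ ht) (sub _ z _ hs)]
      exact (h s hs t ht hst).trans (le_abs_self _)
    intro s hs t ht
    rcases le_total s t with hst | hst
    · exact main s hs t ht hst
    · rw [dist_comm, dist_comm (∫ r in (0:ℝ)..s, k r)]; exact main t ht s hs hst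
  rw [absolutelyContinuousOnInterval_iff] at hK ⊢
  intro ε hε
  obtain ⟨δ, hδ, H⟩ := hK ε hε
  refine ⟨δ, hδ, fun I hI hlt => lt_of_le_of_lt (Finset.sum_le_sum fun i hi => ?_) (H I hI hlt)⟩
  have := hI.1 i hi
  rw [uIcc_of_le ha] at this
  exact key _ this.1 _ this.2

lemma L2Dominated.absolutelyContinuousOnInterval (ha : 0 ≤ a) {g : ℝ → E}
    (h : L2Dominated a g) : AbsolutelyContinuousOnInterval g 0 a := by
  obtain ⟨k, -, hk, h⟩ := h
  exact absolutelyContinuousOnInterval_of_norm_sub_le ha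
    (MemLp.intervalIntegrable_of_mem_Icc hk ⟨le_rfl, ha⟩ ⟨ha, le_rfl⟩) h

lemma L2Dominated.continuousOn (ha : 0 ≤ a) {g : ℝ → E} (h : L2Dominated a g) :
    ContinuousOn g (Icc 0 a) := by
  have := (h.absolutelyContinuousOnInterval ha).continuousOn
  rwa [uIcc_of_le ha] at this

lemma L2Dominated.exists_bound (ha : 0 ≤ a) {g : ℝ → E} (h : L2Dominated a g) :
    ∃ C, 0 ≤ C ∧ ∀ t ∈ Icc 0 a, ‖g t‖ ≤ C := by
  obtain ⟨C, hC⟩ := isCompact_Icc.exists_bound_of_continuousOn (h.continuousOn ha)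
  exact ⟨max C 0, le_max_right _ _, fun t ht => (hC t ht).trans (le_max_left _ _)⟩

/-- This comparison and its two-function version are the reason for working with increments: closure
of `W^{1,2}` under algebraic operations follows from pointwise inequalities, with no derivative
computed. -/
lemma L2Dominated.of_norm_sub_le {E' : Type*} [NormedAddCommGroup E'] {f : ℝ → E} {g : ℝ → E'}
    (hf : L2Dominated a f) {C : ℝ} (hC : 0 ≤ C)
    (h : ∀ s ∈ Icc 0 a, ∀ t ∈ Icc 0 a, s ≤ t → ‖g t - g s‖ ≤ C * ‖f t - f s‖) :
    L2Dominated a g := by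
  obtain ⟨k, k0, hk, hf⟩ := hf
  refine ⟨fun t => C * k t, fun t => mul_nonneg hC (k0 t), hk.const_mul C, fun s hs t ht hst => ?_⟩
  rw [intervalIntegral.integral_const_mul]
  exact (h s hs t ht hst).trans (by gcongr; exact hf s hs t ht hst)

lemma L2Dominated.of_norm_sub_le_add {E₁ E₂ : Type*} [NormedAddCommGroup E₁]
    [NormedAddCommGroup E₂] {f₁ : ℝ → E₁} {f₂ : ℝ → E₂} {g : ℝ → E}
    (h₁ : L2Dominated a f₁) (h₂ : L2Dominated a f₂) {C : ℝ} (hC : 0 ≤ C)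
    (h : ∀ s ∈ Icc 0 a, ∀ t ∈ Icc 0 a, s ≤ t →
      ‖g t - g s‖ ≤ C * (‖f₁ t - f₁ s‖ + ‖f₂ t - f₂ s‖)) :
    L2Dominated a g := by
  obtain ⟨k₁, k0₁, hk₁, hf₁⟩ := h₁
  obtain ⟨k₂, k0₂, hk₂, hf₂⟩ := h₂
  refine ⟨fun t => C * (k₁ t + k₂ t), fun t => mul_nonneg hC (add_nonneg (k0₁ t) (k0₂ t)),
    (hk₁.add hk₂).const_mul C, fun s hs t ht hst => ?_⟩
  rw [intervalIntegral.integral_const_mul, intervalIntegral.integral_add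
    (MemLp.intervalIntegrable_of_mem_Icc hk₁ hs ht) (MemLp.intervalIntegrable_of_mem_Icc hk₂ hs ht)]
  exact (h s hs t ht hst).trans (by gcongr; exacts [hf₁ s hs t ht hst, hf₂ s hs t ht hst])

lemma L2Dominated.congr {f g : ℝ → E} (hf : L2Dominated a f) (h : ∀ t ∈ Icc 0 a, g t = f t) :
    L2Dominated a g :=
  hf.of_norm_sub_le zero_le_one fun s hs t ht _ => by rw [h s hs, h t ht, one_mul]

lemma L2Dominated.const (c : E) : L2Dominated a fun _ => c :=
  ⟨0, fun _ => le_rfl, MemLp.zero, fun s _ t _ _ => by simp⟩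

lemma L2Dominated.add {f g : ℝ → E} (hf : L2Dominated a f) (hg : L2Dominated a g) :
    L2Dominated a fun t => f t + g t :=
  hf.of_norm_sub_le_add hg zero_le_one fun s _ t _ _ => by
    rw [one_mul, add_sub_add_comm]; exact norm_add_le _ _

lemma L2Dominated.sub {f g : ℝ → E} (hf : L2Dominated a f) (hg : L2Dominated a g) :
    L2Dominated a fun t => f t - g t :=
  hf.of_norm_sub_le_add hg zero_le_one fun s _ t _ _ => by
    rw [one_mul, sub_sub_sub_comm]; exact norm_sub_le _ _

lemma L2Dominated.sum {ι : Type*} (s : Finset ι) {f : ι → ℝ → E}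
    (hf : ∀ i ∈ s, L2Dominated a (f i)) : L2Dominated a fun t => ∑ i ∈ s, f i t := by
  classical
  induction s using Finset.induction_on with
  | empty => simpa using L2Dominated.const (0 : E)
  | insert i s hi ih =>
    simp only [Finset.sum_insert hi]
    exact (hf i (by simp)).add (ih fun j hj => hf j (by simp [hj]))

lemma L2Dominated.smul {𝕜 : Type*} [NormedField 𝕜] [NormedSpace 𝕜 E] (ha : 0 ≤ a) {f : ℝ → 𝕜}
    {g : ℝ → E} (hf : L2Dominated a f) (hg : L2Dominated a g) :
    L2Dominated a fun t => f t • g t := by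
  obtain ⟨C, hC, hCf⟩ := hf.exists_bound ha
  obtain ⟨D, hD, hDg⟩ := hg.exists_bound ha
  refine hf.of_norm_sub_le_add hg (add_nonneg hC hD) fun s hs t ht _ => ?_
  have : f t • g t - f s • g s = (f t - f s) • g t + f s • (g t - g s) := by
    rw [sub_smul, smul_sub]; abel
  rw [this]
  refine (norm_add_le _ _).trans ?_
  rw [norm_smul, norm_smul]
  have h1 := mul_le_mul_of_nonneg_left (hDg t ht) (norm_nonneg (f t - f s))
  have h2 := mul_le_mul_of_nonneg_right (hCf s hs) (norm_nonneg (g t - g s))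
  nlinarith [mul_nonneg hC (norm_nonneg (f t - f s)), mul_nonneg hD (norm_nonneg (g t - g s))]

lemma L2Dominated.of_primitive [NormedSpace ℝ E] (ha : 0 ≤ a) {u g : ℝ → E}
    (hg : MemLp g 2 (volume.restrict (Icc 0 a)))
    (h : ∀ t ∈ Icc 0 a, u t = u 0 + ∫ s in (0 : ℝ)..t, g s) : L2Dominated a u := by
  have z : (0:ℝ) ∈ Icc 0 a := ⟨le_rfl, ha⟩
  refine ⟨fun t => ‖g t‖, fun t => norm_nonneg _, hg.norm, fun s hs t ht hst => ?_⟩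
  rw [h s hs, h t ht, add_sub_add_left_eq_sub,
    intervalIntegral.integral_interval_sub_left (MemLp.intervalIntegrable_of_mem_Icc hg z ht)
      (MemLp.intervalIntegrable_of_mem_Icc hg z hs)]
  exact intervalIntegral.norm_integral_le_integral_norm hst

lemma ae_hasDerivAt_of_primitive [NormedSpace ℝ E] [CompleteSpace E] (ha : 0 ≤ a) {u g : ℝ → E}
    (hg : MemLp g 2 (volume.restrict (Icc 0 a)))
    (h : ∀ t ∈ Icc 0 a, u t = u 0 + ∫ s in (0 : ℝ)..t, g s) :
    ∀ᵐ t, t ∈ uIcc 0 a → HasDerivAt u (g t) t := by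
  have z : (0:ℝ) ∈ Icc 0 a := ⟨le_rfl, ha⟩
  -- The formula for `u` holds only on `[0,a]`, so a two-sided derivative is available only at
  -- interior points.
  have h₁ : ∀ᵐ x : ℝ, x ≠ 0 := by simp [ae_iff, measure_singleton]
  have h₂ : ∀ᵐ x : ℝ, x ≠ a := by simp [ae_iff, measure_singleton]
  filter_upwards [(MemLp.intervalIntegrable_of_mem_Icc hg z
    (⟨ha, le_rfl⟩ : a ∈ Icc 0 a)).ae_hasDerivAt_integral, h₁, h₂] with t ht h1 h2 hta
  have := (ht hta 0 (by simp)).const_add (u 0)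
  refine this.congr_of_eventuallyEq ?_
  rw [uIcc_of_le ha] at hta
  filter_upwards [Ioo_mem_nhds (lt_of_le_of_ne hta.1 (Ne.symm h1)) (lt_of_le_of_ne hta.2 h2)]
    with y hy using h y ⟨hy.1.le, hy.2.le⟩

/-- The difference of `f` and the primitive of `f'` is absolutely continuous with derivative zero
almost everywhere, hence constant. -/
lemma AbsolutelyContinuousOnInterval.integral_eq_sub_of_ae_hasDerivAt [NormedSpace ℝ E]
    [CompleteSpace E] (ha : 0 ≤ a) {f f' : ℝ → E} (hf : AbsolutelyContinuousOnInterval f 0 a)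
    (hd : ∀ᵐ t, t ∈ uIcc 0 a → HasDerivAt f (f' t) t) (hi : IntervalIntegrable f' volume 0 a) :
    ∫ t in (0:ℝ)..a, f' t = f a - f 0 := by
  have hsub : ∀ s ∈ Icc 0 a, ∀ t ∈ Icc 0 a, IntervalIntegrable f' volume s t := fun s hs t ht =>
    hi.mono_set (by rw [uIcc_of_le ha]; exact uIcc_subset_Icc hs ht)
  have z : (0:ℝ) ∈ Icc 0 a := ⟨le_rfl, ha⟩
  have hac : AbsolutelyContinuousOnInterval (fun t => ∫ s in (0:ℝ)..t, f' s) 0 a := by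
    refine absolutelyContinuousOnInterval_of_norm_sub_le ha hi.norm fun s hs t ht hst => ?_
    rw [intervalIntegral.integral_interval_sub_left (hsub _ z _ ht) (hsub _ z _ hs)]
    exact intervalIntegral.norm_integral_le_integral_norm hst
  obtain ⟨C, hC⟩ := (hf.sub hac).const_of_ae_hasDerivAt_zero (by
    filter_upwards [hd, hi.ae_hasDerivAt_integral] with t h1 h2 ht
    simpa using (h1 ht).sub (h2 ht 0 (by simp)))
  have h0 := hC 0 (by simp)
  have h1 := hC a (by simp)
  simp only [Pi.sub_apply, intervalIntegral.integral_same, sub_zero] at h0 h1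
  rw [h0, ← h1]; abel

/-- Integration by parts for scalar functions of class `W^{1,2}`. -/
lemma integral_mul_add_mul_of_primitive (ha : 0 ≤ a) {f f' g g' : ℝ → ℂ}
    (hf' : MemLp f' 2 (volume.restrict (Icc 0 a)))
    (hf : ∀ t ∈ Icc 0 a, f t = f 0 + ∫ s in (0 : ℝ)..t, f' s)
    (hg' : MemLp g' 2 (volume.restrict (Icc 0 a)))
    (hg : ∀ t ∈ Icc 0 a, g t = g 0 + ∫ s in (0 : ℝ)..t, g' s) :
    IntervalIntegrable (fun t => f' t * g t) volume 0 a ∧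
    IntervalIntegrable (fun t => f t * g' t) volume 0 a ∧
    (∫ t in (0:ℝ)..a, f' t * g t) + (∫ t in (0:ℝ)..a, f t * g' t) = f a * g a - f 0 * g 0 := by
  have hF := L2Dominated.of_primitive ha hf' hf
  have hG := L2Dominated.of_primitive ha hg' hg
  have z : (0:ℝ) ∈ Icc 0 a := ⟨le_rfl, ha⟩
  have az : a ∈ Icc 0 a := ⟨ha, le_rfl⟩
  have i1 : IntervalIntegrable (fun t => f' t * g t) volume 0 a :=
    (MemLp.intervalIntegrable_of_mem_Icc hf' z az).mul_continuousOn
      (by rw [uIcc_of_le ha]; exact hG.continuousOn ha)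
  have i2 : IntervalIntegrable (fun t => f t * g' t) volume 0 a :=
    (MemLp.intervalIntegrable_of_mem_Icc hg' z az).continuousOn_mul
      (by rw [uIcc_of_le ha]; exact hF.continuousOn ha)
  refine ⟨i1, i2, ?_⟩
  rw [← intervalIntegral.integral_add i1 i2]
  refine AbsolutelyContinuousOnInterval.integral_eq_sub_of_ae_hasDerivAt ha
    (f := fun t => f t * g t) ((hF.smul ha hG).absolutelyContinuousOnInterval ha) ?_ (i1.add i2)
  filter_upwards [ae_hasDerivAt_of_primitive ha hf' hf, ae_hasDerivAt_of_primitive ha hg' hg]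
    with t h1 h2 ht using (h1 ht).mul (h2 ht)

/-- A real absolutely continuous function is the integral of its derivative. Comparing difference
quotients of `c` with those of the primitive of `k` gives `|c'| ≤ k` almost everywhere, so `c'` is
in `L²`. -/
lemma L2Dominated.real_primitive (ha : 0 ≤ a) {c : ℝ → ℝ} (hc : L2Dominated a c) :
    MemLp (deriv c) 2 (volume.restrict (Icc 0 a)) ∧
      ∀ t ∈ Icc 0 a, c t = c 0 + ∫ s in (0:ℝ)..t, deriv c s := by
  have hac := hc.absolutelyContinuousOnInterval ha
  obtain ⟨k, k0, hk, h⟩ := hc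
  have z : (0:ℝ) ∈ Icc 0 a := ⟨le_rfl, ha⟩
  have ki := fun s hs t ht => MemLp.intervalIntegrable_of_mem_Icc hk (s := s) (t := t) hs ht
  have h₁ : ∀ᵐ x : ℝ, x ≠ 0 := by simp [ae_iff, measure_singleton]
  have h₂ : ∀ᵐ x : ℝ, x ≠ a := by simp [ae_iff, measure_singleton]
  constructor
  · refine hk.of_le (measurable_deriv c).aestronglyMeasurable ?_
    rw [ae_restrict_iff' measurableSet_Icc]
    filter_upwards [(ki 0 z a ⟨ha, le_rfl⟩).ae_hasDerivAt_integral, hac.ae_differentiableAt,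
      h₁, h₂] with t ht hct h1 h2 hta
    rw [uIcc_of_le ha] at ht hct
    have hd := (hct hta).hasDerivAt
    have hK := ht hta 0 z
    rw [Real.norm_of_nonneg (k0 t)]
    have t1 := (hasDerivAt_iff_tendsto_slope.1 hd).norm
    have t2 := (hasDerivAt_iff_tendsto_slope.1 hK).norm
    rw [Real.norm_of_nonneg (k0 t)] at t2
    refine le_of_tendsto_of_tendsto t1 t2 ?_
    filter_upwards [nhdsWithin_le_nhds (Ioo_mem_nhds (lt_of_le_of_ne hta.1 (Ne.symm h1))
      (lt_of_le_of_ne hta.2 h2))] with y hy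
    have hy' : y ∈ Icc 0 a := ⟨hy.1.le, hy.2.le⟩
    simp only [slope, vsub_eq_sub, smul_eq_mul, norm_mul]
    refine mul_le_mul_of_nonneg_left ?_ (norm_nonneg _)
    rw [intervalIntegral.integral_interval_sub_left (ki 0 z y hy') (ki 0 z t hta)]
    rcases le_total t y with hty | hty
    · exact (h t hta y hy' hty).trans (le_abs_self _)
    · rw [norm_sub_rev, intervalIntegral.integral_symm, norm_neg]
      exact (h y hy' t hta hty).trans (le_abs_self _)
  · intro t ht
    have := (hac.mono (c := 0) (d := t) (by
      rw [uIcc_of_le ha, uIcc_of_le ht.1]; exact Icc_subset_Icc le_rfl ht.2)).integral_deriv_eq_sub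
    rw [this]; ring

/-- The converse of `L2Dominated.of_primitive` for `ℂ^m`, obtained from the real and imaginary parts
of each coordinate. -/
lemma L2Dominated.exists_hasSobolevDeriv {m : ℕ} (ha : 0 ≤ a) {g : ℝ → Fin m → ℂ}
    (hg : L2Dominated a g) : ∃ g' : ℝ → Fin m → ℂ, HasSobolevDeriv a g g' := by
  have hre : ∀ i, L2Dominated a fun t => (g t i).re := fun i =>
    hg.of_norm_sub_le zero_le_one fun s _ t _ _ => by
      rw [one_mul, ← Complex.sub_re, ← Pi.sub_apply]
      exact (Complex.abs_re_le_norm _).trans (norm_le_pi_norm _ i)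
  have him : ∀ i, L2Dominated a fun t => (g t i).im := fun i =>
    hg.of_norm_sub_le zero_le_one fun s _ t _ _ => by
      rw [one_mul, ← Complex.sub_im, ← Pi.sub_apply]
      exact (Complex.abs_im_le_norm _).trans (norm_le_pi_norm _ i)
  have hre' := fun i => (hre i).real_primitive ha
  have him' := fun i => (him i).real_primitive ha
  have h1 : ∀ i, MemLp (fun t => ((deriv (fun t => (g t i).re) t : ℝ) : ℂ)) 2
    (volume.restrict (Icc 0 a)) := fun i => (hre' i).1.ofReal
  have h2 : ∀ i, MemLp (fun t => ((deriv (fun t => (g t i).im) t : ℝ) : ℂ)) 2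
    (volume.restrict (Icc 0 a)) := fun i => (him' i).1.ofReal
  have hm : MemLp (fun t i => ((deriv (fun t => (g t i).re) t : ℝ) : ℂ) +
      ((deriv (fun t => (g t i).im) t : ℝ) : ℂ) * Complex.I) 2 (volume.restrict (Icc 0 a)) := by
    refine MemLp.of_eval fun i => ?_
    exact (h1 i).add ((h2 i).mul_const Complex.I)
  have z : (0:ℝ) ∈ Icc 0 a := ⟨le_rfl, ha⟩
  refine ⟨_, hm, fun t ht => ?_⟩
  ext i
  have e := fun (f : ℝ → Fin m → ℂ) (hf : IntervalIntegrable f volume 0 t) =>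
    (ContinuousLinearMap.proj (R := ℝ) (φ := fun _ : Fin m => ℂ) i).intervalIntegral_comp_comm hf
  have e' := e _ (MemLp.intervalIntegrable_of_mem_Icc hm z ht)
  simp only [ContinuousLinearMap.proj_apply] at e'
  have j1 := MemLp.intervalIntegrable_of_mem_Icc (h1 i) z ht
  have j2 := MemLp.intervalIntegrable_of_mem_Icc (h2 i) z ht
  rw [Pi.add_apply, ← e', intervalIntegral.integral_add j1 (j2.mul_const _),
    intervalIntegral.integral_mul_const, intervalIntegral.integral_ofReal,
    intervalIntegral.integral_ofReal]
  rw [show ∫ x in (0:ℝ)..t, deriv (fun t => (g t i).re) x = (g t i).re - (g 0 i).re from by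
    rw [(hre' i).2 t ht]; ring, show ∫ x in (0:ℝ)..t, deriv (fun t => (g t i).im) x =
    (g t i).im - (g 0 i).im from by rw [(him' i).2 t ht]; ring]
  apply Complex.ext <;> simp

end Sobolev

/-! ### The sesquilinear form of the Sturm operator. -/

section SturmForm

variable {m : ℕ} {a : ℝ}

/-- `v₁` is the continuous derivative of `v` on `[0,a]`. -/
def IsC1Pair {m : ℕ} (a : ℝ) (v v₁ : ℝ → Fin m → ℂ) : Prop :=
  ContinuousOn v₁ (Icc 0 a) ∧ ∀ t ∈ Icc 0 a, HasDerivWithinAt v (v₁ t) (Icc 0 a) t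

lemma IsC1Pair.continuousOn {v v₁ : ℝ → Fin m → ℂ} (h : IsC1Pair a v v₁) :
    ContinuousOn v (Icc 0 a) :=
  fun t ht => (h.2 t ht).continuousWithinAt

lemma ContinuousOn.memLp_two_Icc {E : Type*} [NormedAddCommGroup E] {g : ℝ → E}
    (hg : ContinuousOn g (Icc 0 a)) : MemLp g 2 (volume.restrict (Icc 0 a)) := by
  obtain ⟨C, hC⟩ := isCompact_Icc.exists_bound_of_continuousOn hg
  refine MemLp.of_bound (hg.aestronglyMeasurable measurableSet_Icc) C ?_
  rw [ae_restrict_iff' measurableSet_Icc]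
  exact Filter.Eventually.of_forall hC

lemma IsC1Pair.hasSobolevDeriv {v v₁ : ℝ → Fin m → ℂ} (h : IsC1Pair a v v₁) :
    HasSobolevDeriv a v v₁ := by
  refine ⟨h.1.memLp_two_Icc, fun t ht => ?_⟩
  have hs : Icc 0 t ⊆ Icc 0 a := Icc_subset_Icc le_rfl ht.2
  rw [intervalIntegral.integral_eq_sub_of_hasDeriv_right_of_le ht.1 (f := v)
    (h.continuousOn.mono hs)]
  · abel
  · intro x hx
    have := h.2 x ⟨hx.1.le, hx.2.le.trans ht.2⟩
    exact (this.hasDerivAt (Icc_mem_nhds hx.1 (hx.2.trans_le ht.2))).hasDerivWithinAt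
  · refine ContinuousOn.intervalIntegrable ?_
    rw [uIcc_of_le ht.1]; exact h.1.mono hs

lemma HasSobolevDeriv.l2Dominated (ha : 0 ≤ a) {v v₁ : ℝ → Fin m → ℂ}
    (h : HasSobolevDeriv a v v₁) : L2Dominated a v :=
  L2Dominated.of_primitive ha h.1 h.2

/-- Both functions equal the derivative of `v` almost everywhere; continuity removes the exceptional
set. -/
lemma HasSobolevDeriv.eqOn (ha : 0 < a) {v v₁ w₁ : ℝ → Fin m → ℂ} (h : HasSobolevDeriv a v v₁)
    (h' : HasSobolevDeriv a v w₁) (hv : ContinuousOn v₁ (Icc 0 a))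
    (hw : ContinuousOn w₁ (Icc 0 a)) : EqOn v₁ w₁ (Icc 0 a) := by
  refine Measure.eqOn_Icc_of_ae_eq volume ha.ne ?_ hv hw
  rw [Filter.EventuallyEq, ae_restrict_iff' measurableSet_Icc]
  filter_upwards [ae_hasDerivAt_of_primitive ha.le h.1 h.2,
    ae_hasDerivAt_of_primitive ha.le h'.1 h'.2] with t h1 h2 ht
  rw [uIcc_of_le ha.le] at h1 h2
  exact (h1 ht).unique (h2 ht)

lemma HasSobolevDeriv.clm_comp {F : Type*} [NormedAddCommGroup F] [NormedSpace ℝ F]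
    [CompleteSpace F] {v v₁ : ℝ → Fin m → ℂ} (h : HasSobolevDeriv a v v₁)
    (ℓ : (Fin m → ℂ) →L[ℝ] F) :
    MemLp (fun t => ℓ (v₁ t)) 2 (volume.restrict (Icc 0 a)) ∧
      ∀ t ∈ Icc 0 a, ℓ (v t) = ℓ (v 0) + ∫ s in (0:ℝ)..t, ℓ (v₁ s) := by
  refine ⟨ℓ.comp_memLp' h.1, fun t ht => ?_⟩
  rw [ℓ.intervalIntegral_comp_comm
    (MemLp.intervalIntegrable_of_mem_Icc h.1 ⟨le_rfl, ht.1.trans ht.2⟩ ht), ← map_add, ← h.2 t ht]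

/-- Integration by parts for vector functions of class `W^{1,2}`. -/
lemma HasSobolevDeriv.integral_dotProduct_star (ha : 0 ≤ a) {y w v v₁ : ℝ → Fin m → ℂ}
    (hy : HasSobolevDeriv a y w) (hv : HasSobolevDeriv a v v₁) :
    IntervalIntegrable (fun t => w t ⬝ᵥ star (v t)) volume 0 a ∧
    IntervalIntegrable (fun t => y t ⬝ᵥ star (v₁ t)) volume 0 a ∧
    (∫ t in (0:ℝ)..a, w t ⬝ᵥ star (v t)) + (∫ t in (0:ℝ)..a, y t ⬝ᵥ star (v₁ t)) =
      y a ⬝ᵥ star (v a) - y 0 ⬝ᵥ star (v 0) := by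
  have key := fun i : Fin m =>
    have h1 := hy.clm_comp (ContinuousLinearMap.proj (R := ℝ) (φ := fun _ : Fin m => ℂ) i)
    have h2 := hv.clm_comp ((Complex.conjCLE : ℂ →L[ℝ] ℂ).comp
      (ContinuousLinearMap.proj (R := ℝ) (φ := fun _ : Fin m => ℂ) i))
    integral_mul_add_mul_of_primitive ha h1.1 h1.2 h2.1 h2.2
  simp only [ContinuousLinearMap.proj_apply, ContinuousLinearMap.comp_apply,
    ContinuousLinearEquiv.coe_coe, Complex.conjCLE_apply] at key
  simp only [dotProduct, Pi.star_apply, RCLike.star_def]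
  refine ⟨?_, ?_, ?_⟩
  · simpa only [Finset.sum_fn] using IntervalIntegrable.sum Finset.univ fun i _ => (key i).1
  · simpa only [Finset.sum_fn] using IntervalIntegrable.sum Finset.univ fun i _ => (key i).2.1
  · rw [intervalIntegral.integral_finsetSum fun i _ => (key i).1,
      intervalIntegral.integral_finsetSum fun i _ => (key i).2.1, ← Finset.sum_add_distrib,
      ← Finset.sum_sub_distrib]
    exact Finset.sum_congr rfl fun i _ => (key i).2.2

lemma cMat_mulVec_dotProduct_star (A : Matrix (Fin m) (Fin m) ℝ) (v w : Fin m → ℂ) :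
    (cMat A).mulVec v ⬝ᵥ star w = v ⬝ᵥ star ((cMat A.transpose).mulVec w) := by
  have : (cMat A.transpose).conjTranspose = cMat A := by
    ext i j; simp [cMat, Matrix.conjTranspose_apply]
  rw [Matrix.star_mulVec, this, dotProduct_comm, Matrix.dotProduct_mulVec, dotProduct_comm]

lemma continuous_cMat : Continuous (cMat : Matrix (Fin m) (Fin m) ℝ → _) :=
  continuous_id.matrix_map Complex.continuous_ofReal

lemma ContinuousOn.cMat_mulVec {X : Type*} [TopologicalSpace X] {s : Set X}
    {A : X → Matrix (Fin m) (Fin m) ℝ} {v : X → Fin m → ℂ}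
    (hA : ContinuousOn A s) (hv : ContinuousOn v s) :
    ContinuousOn (fun t => (cMat (A t)).mulVec (v t)) s := by
  refine continuousOn_pi.2 fun i => ?_
  simp only [Matrix.mulVec, dotProduct, cMat, Matrix.map_apply]
  refine continuousOn_finsetSum _ fun j _ => ContinuousOn.mul ?_ (continuousOn_pi.1 hv j)
  exact Complex.continuous_ofReal.comp_continuousOn
    (continuousOn_pi.1 (continuousOn_pi.1 hA i) j)

lemma continuousOn_dotProduct_star {X : Type*} [TopologicalSpace X] {s : Set X}
    {v w : X → Fin m → ℂ} (hv : ContinuousOn v s) (hw : ContinuousOn w s) :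
    ContinuousOn (fun t => v t ⬝ᵥ star (w t)) s := by
  have : Continuous fun p : (Fin m → ℂ) × (Fin m → ℂ) => p.1 ⬝ᵥ star p.2 :=
    continuous_fst.dotProduct (continuous_star.comp continuous_snd)
  exact this.comp_continuousOn' (ContinuousOn.prodMk hv hw)

/-- The integrand of the sesquilinear form of the Sturm operator. -/
noncomputable def sturmDensity (A B C : Matrix (Fin m) (Fin m) ℝ) (v v₁ w w₁ : Fin m → ℂ) : ℂ :=
  ((cMat A).mulVec v₁ + (cMat B).mulVec v) ⬝ᵥ star w₁ +
    ((cMat B.transpose).mulVec v₁ + (cMat C).mulVec v) ⬝ᵥ star w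

lemma star_dotProduct_star (v w : Fin m → ℂ) : star (v ⬝ᵥ star w) = w ⬝ᵥ star v := by
  simp [dotProduct, mul_comm]

lemma star_sturmDensity {A B C : Matrix (Fin m) (Fin m) ℝ} (hA : A.transpose = A)
    (hC : C.transpose = C) (v v₁ w w₁ : Fin m → ℂ) :
    star (sturmDensity A B C v v₁ w w₁) = sturmDensity A B C w w₁ v v₁ := by
  simp only [sturmDensity, add_dotProduct, star_add, cMat_mulVec_dotProduct_star, hA, hC,
    Matrix.transpose_transpose, star_dotProduct_star]
  ring

lemma sturmDensity_add_smul (A B C : Matrix (Fin m) (Fin m) ℝ) (v v₁ w w₁ : Fin m → ℂ) (ε : ℝ) :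
    sturmDensity A B C (v + ε • w) (v₁ + ε • w₁) (v + ε • w) (v₁ + ε • w₁) =
      sturmDensity A B C v v₁ v v₁ +
      ε * (sturmDensity A B C v v₁ w w₁ + sturmDensity A B C w w₁ v v₁) +
      ε ^ 2 * sturmDensity A B C w w₁ w w₁ := by
  simp only [sturmDensity, ← Complex.coe_smul, Matrix.mulVec_add, Matrix.mulVec_smul, star_add,
    star_smul, add_dotProduct, dotProduct_add, smul_dotProduct, dotProduct_smul, smul_eq_mul,
    RCLike.star_def, Complex.conj_ofReal]
  ring

/-- The sesquilinear form `⟨A v, w⟩` of the Sturm operator with Neumann boundary conditions. -/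
noncomputable def sturmForm (P Q R : ℝ → Matrix (Fin m) (Fin m) ℝ) (a : ℝ) (v v₁ w w₁ : ℝ → Fin m → ℂ) : ℂ :=
  (∫ t in (0:ℝ)..a, sturmDensity (P t) (Q t) (R t) (v t) (v₁ t) (w t) (w₁ t)) -
    ((cMat (Q a)).mulVec (v a) ⬝ᵥ star (w a) - (cMat (Q 0)).mulVec (v 0) ⬝ᵥ star (w 0))

/-- Regularity, symmetry and definiteness of the coefficients of a Sturm operator on `[0,a]`. -/
structure IsLegendreCoeff (P Q R : ℝ → Matrix (Fin m) (Fin m) ℝ) (a : ℝ) : Prop where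
  contP : ContinuousOn P (Icc 0 a)
  contQ : ContinuousOn Q (Icc 0 a)
  contR : ContinuousOn R (Icc 0 a)
  symmP : ∀ t ∈ Icc 0 a, (P t).transpose = P t
  symmR : ∀ t ∈ Icc 0 a, (R t).transpose = R t
  posP : ∀ t ∈ Icc 0 a, ∀ w : Fin m → ℝ, w ≠ 0 → 0 < (P t).mulVec w ⬝ᵥ w

variable {P Q R : ℝ → Matrix (Fin m) (Fin m) ℝ}

lemma det_ne_zero_of_forall_pos {A : Matrix (Fin m) (Fin m) ℝ}
    (hA : ∀ w : Fin m → ℝ, w ≠ 0 → 0 < A.mulVec w ⬝ᵥ w) : A.det ≠ 0 := by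
  intro h0
  obtain ⟨w, hw, hw0⟩ := Matrix.exists_mulVec_eq_zero_iff.2 h0
  have := hA w hw
  rw [hw0, zero_dotProduct] at this
  exact lt_irrefl _ this

lemma isUnit_det_cMat {A : Matrix (Fin m) (Fin m) ℝ}
    (hA : ∀ w : Fin m → ℝ, w ≠ 0 → 0 < A.mulVec w ⬝ᵥ w) : IsUnit (cMat A).det := by
  have : (cMat A).det = ((A.det : ℝ) : ℂ) := (RingHom.map_det Complex.ofRealHom A).symm
  rw [this, isUnit_iff_ne_zero]
  exact_mod_cast det_ne_zero_of_forall_pos hA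

lemma IsLegendreCoeff.continuousOn_inv (h : IsLegendreCoeff P Q R a) :
    ContinuousOn (fun t => (cMat (P t))⁻¹) (Icc 0 a) := by
  have hc : ContinuousOn (fun t => cMat (P t)) (Icc 0 a) := continuous_cMat.comp_continuousOn h.contP
  have e : ∀ t, (cMat (P t))⁻¹ = (cMat (P t)).det⁻¹ • (cMat (P t)).adjugate := fun t => by
    rw [Matrix.inv_def, Ring.inverse_eq_inv']
  simp only [e]
  refine ContinuousOn.smul (ContinuousOn.inv₀ ?_ fun t ht =>
    (isUnit_det_cMat (h.posP t ht)).ne_zero) ?_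
  · exact (Continuous.matrix_det continuous_id).comp_continuousOn hc
  · exact (Continuous.matrix_adjugate continuous_id).comp_continuousOn hc

lemma IsLegendreCoeff.inv_mulVec (h : IsLegendreCoeff P Q R a) {t : ℝ} (ht : t ∈ Icc 0 a)
    (v : Fin m → ℂ) : (cMat (P t))⁻¹.mulVec ((cMat (P t)).mulVec v) = v := by
  rw [Matrix.mulVec_mulVec, Matrix.nonsing_inv_mul _ (isUnit_det_cMat (h.posP t ht)),
    Matrix.one_mulVec]

lemma IsLegendreCoeff.continuousOn_density (h : IsLegendreCoeff P Q R a) {X : Type*}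
    [TopologicalSpace X] {s : Set X} {τ : X → ℝ} {v v₁ w w₁ : X → Fin m → ℂ}
    (hτ : ContinuousOn τ s) (hτs : MapsTo τ s (Icc 0 a))
    (hv : ContinuousOn v s) (hv₁ : ContinuousOn v₁ s)
    (hw : ContinuousOn w s) (hw₁ : ContinuousOn w₁ s) :
    ContinuousOn (fun x => sturmDensity (P (τ x)) (Q (τ x)) (R (τ x)) (v x) (v₁ x) (w x) (w₁ x))
      s := by
  have hP := h.contP.comp hτ hτs
  have hQ := h.contQ.comp hτ hτs
  have hR := h.contR.comp hτ hτs
  have hQt : ContinuousOn (fun x => (Q (τ x)).transpose) s :=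
    (Continuous.matrix_transpose continuous_id).comp_continuousOn hQ
  exact (continuousOn_dotProduct_star ((hP.cMat_mulVec hv₁).add (hQ.cMat_mulVec hv)) hw₁).add
    (continuousOn_dotProduct_star ((hQt.cMat_mulVec hv₁).add (hR.cMat_mulVec hv)) hw)

lemma IsLegendreCoeff.intervalIntegrable_density (ha : 0 ≤ a) (h : IsLegendreCoeff P Q R a)
    {v v₁ w w₁ : ℝ → Fin m → ℂ} (hv : IsC1Pair a v v₁) (hw : IsC1Pair a w w₁) :
    IntervalIntegrable
      (fun t => sturmDensity (P t) (Q t) (R t) (v t) (v₁ t) (w t) (w₁ t)) volume 0 a := by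
  refine ContinuousOn.intervalIntegrable ?_
  rw [uIcc_of_le ha]
  exact h.continuousOn_density continuousOn_id (mapsTo_id _) hv.continuousOn hv.1
    hw.continuousOn hw.1

/-- On the Neumann space `⟨A v, v⟩` is given by the form; in particular the form is positive. -/
lemma SturmPosDefNeumann.form_of_neumann (ha : 0 < a) (h : IsLegendreCoeff P Q R a)
    (hpos : SturmPosDefNeumann P Q R a) {v v₁ : ℝ → Fin m → ℂ} (hv : IsC1Pair a v v₁)
    (hv₁ : L2Dominated a v₁) (h0 : v₁ 0 = 0) (h1 : v₁ a = 0) :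
    (sturmForm P Q R a v v₁ v v₁).im = 0 ∧ 0 ≤ (sturmForm P Q R a v v₁ v v₁).re ∧
    ((∃ t ∈ Icc 0 a, v t ≠ 0) → 0 < (sturmForm P Q R a v v₁ v v₁).re) ∧
    L2Dominated a (fun t => (cMat (P t)).mulVec (v₁ t) + (cMat (Q t)).mulVec (v t)) := by
  obtain ⟨v₂, hv₂⟩ := hv₁.exists_hasSobolevDeriv ha.le
  obtain ⟨f, ⟨u₁, w, hu₁, hw, hf⟩, hfpos⟩ := hpos v ⟨v₁, v₂, hv.hasSobolevDeriv, hv₂, h0, h1⟩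
  have hdom := hw.l2Dominated ha.le
  -- The derivative `u₁` supplied with the Sturm image is only an `L²` function. Solving the
  -- momentum `P u₁ + Q v`, which is continuous, for `u₁` shows that it is continuous, so it is `v₁`
  -- itself.
  have hu₁c : ContinuousOn u₁ (Icc 0 a) := by
    have h1 := (hdom.continuousOn ha.le).sub (h.contQ.cMat_mulVec hv.continuousOn)
    have : Continuous fun p : Matrix (Fin m) (Fin m) ℂ × (Fin m → ℂ) => p.1.mulVec p.2 :=
      continuous_fst.matrix_mulVec continuous_snd
    refine (this.comp_continuousOn (h.continuousOn_inv.prodMk h1)).congr fun t ht => ?_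
    simp only [add_sub_cancel_right, Function.comp_apply, Pi.sub_apply]
    rw [h.inv_mulVec ht]
  have heq := hu₁.eqOn ha hv.hasSobolevDeriv hu₁c hv.1
  have hdom' : L2Dominated a
      (fun t => (cMat (P t)).mulVec (v₁ t) + (cMat (Q t)).mulVec (v t)) :=
    hdom.congr fun t ht => by rw [heq ht]
  have hw' : HasSobolevDeriv a
      (fun t => (cMat (P t)).mulVec (v₁ t) + (cMat (Q t)).mulVec (v t)) w :=
    ⟨hw.1, fun t ht => by
      have := hw.2 t ht
      beta_reduce at this ⊢
      rwa [heq ht, heq ⟨le_rfl, ha.le⟩] at this⟩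
  obtain ⟨i1, i2, hibp⟩ := hw'.integral_dotProduct_star ha.le hv.hasSobolevDeriv
  have hform : l2Inner a f v = sturmForm P Q R a v v₁ v v₁ := by
    have e1 : l2Inner a f v = ∫ t in (0:ℝ)..a,
        (sturmDensity (P t) (Q t) (R t) (v t) (v₁ t) (v t) (v₁ t) - (w t ⬝ᵥ star (v t) +
        ((cMat (P t)).mulVec (v₁ t) + (cMat (Q t)).mulVec (v t)) ⬝ᵥ star (v₁ t))) := by
      refine intervalIntegral.integral_congr fun t ht => ?_
      rw [uIcc_of_le ha.le] at ht
      simp only [hf t ht, heq ht, sturmDensity, add_dotProduct, neg_dotProduct]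
      ring
    -- Because `v₁` vanishes at both ends, the boundary term of the integration by parts reduces to
    -- that of `Q v · v̄`, which is what `sturmForm` subtracts.
    rw [e1, intervalIntegral.integral_sub (h.intervalIntegrable_density ha.le hv hv) (i1.add i2),
      intervalIntegral.integral_add i1 i2, hibp, sturmForm, h0, h1]
    simp
  rw [← hform]
  by_cases hne : ∃ t ∈ Icc 0 a, v t ≠ 0
  · exact ⟨(hfpos hne).1, (hfpos hne).2.le, fun _ => (hfpos hne).2, hdom'⟩
  · push Not at hne
    have : l2Inner a f v = 0 := by
      rw [l2Inner, intervalIntegral.integral_congr (g := fun _ => 0)]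
      · simp
      · intro t ht
        rw [uIcc_of_le ha.le] at ht
        simp [hne t ht]
    rw [this]
    exact ⟨rfl, le_rfl, fun ⟨t, ht, hvt⟩ => absurd (hne t ht) hvt, hdom'⟩

end SturmForm

/-! ### Neumann functions are dense enough: nonnegativity of the form on all `C¹` functions. -/

section Density

open Filter Topology

variable {m : ℕ} {a : ℝ} {P Q R : ℝ → Matrix (Fin m) (Fin m) ℝ}

/-- A continuous function on `[0,a]` is a bounded pointwise limit of Lipschitz functions that
vanish at both end points. -/
lemma exists_tendsto_l2Dominated_of_continuousOn (ha : 0 < a) {v₁ : ℝ → Fin m → ℂ}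
    (hv₁ : ContinuousOn v₁ (Icc 0 a)) :
    ∃ (w : ℕ → ℝ → Fin m → ℂ) (M : ℝ), (∀ k, Continuous (w k)) ∧ (∀ k, L2Dominated a (w k)) ∧
      (∀ k, w k 0 = 0) ∧ (∀ k, w k a = 0) ∧ (∀ k, ∀ t ∈ Icc 0 a, ‖w k t‖ ≤ M) ∧
      ∀ t ∈ Ioo 0 a, Tendsto (fun k => w k t) atTop (𝓝 (v₁ t)) := by
  obtain ⟨M, hM⟩ := isCompact_Icc.exists_bound_of_continuousOn hv₁
  set V : ℝ → Fin m → ℂ := IccExtend ha.le (domRestrict (Icc 0 a) v₁) with hV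
  have hVc : Continuous V := hv₁.domRestrict.Icc_extend'
  have hVM : ∀ t, ‖V t‖ ≤ M := fun t => by
    simp only [hV, IccExtend, Function.comp_apply]
    exact hM _ (projIcc 0 a ha.le t).2
  set h : ℕ → ℝ := fun k => 1 / ((k : ℝ) + 1) with hh
  have hpos : ∀ k, 0 < h k := fun k => by positivity
  set F : ℝ → Fin m → ℂ := fun t => ∫ s in (0:ℝ)..t, V s with hF
  have hFd : ∀ t, HasDerivAt F (V t) t := fun t =>
    intervalIntegral.integral_hasDerivAt_right (hVc.intervalIntegrable _ _)
      (hVc.stronglyMeasurableAtFilter _ _) hVc.continuousAt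
  have hFc : Continuous F := continuous_iff_continuousAt.2 fun t => (hFd t).continuousAt
  -- Forward averages of `V` over windows of length `h k`: differentiable, bounded by `M`, and
  -- convergent to `V` pointwise.
  set W : ℕ → ℝ → Fin m → ℂ := fun k t => (h k)⁻¹ • (F (t + h k) - F t) with hW
  have hWc : ∀ k, Continuous (W k) := fun k => by fun_prop
  have hWM : ∀ k t, ‖W k t‖ ≤ M := fun k t => by
    have : F (t + h k) - F t = ∫ s in t..(t + h k), V s := by
      rw [hF]
      exact intervalIntegral.integral_interval_sub_left (hVc.intervalIntegrable _ _)
        (hVc.intervalIntegrable _ _)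
    simp only [hW]
    rw [norm_smul, this, norm_inv, Real.norm_of_nonneg (hpos k).le, inv_mul_le_iff₀ (hpos k)]
    have := intervalIntegral.norm_integral_le_of_norm_le_const (a := t) (b := t + h k)
      (fun s _ => hVM s)
    rwa [add_sub_cancel_left, abs_of_pos (hpos k), mul_comm] at this
  have hWd : ∀ k, L2Dominated a (W k) := fun k => by
    have hc : IsC1Pair a (W k) (fun t => (h k)⁻¹ • (V (t + h k) - V t)) :=
      ⟨by fun_prop, fun t _ => by
        refine HasDerivAt.hasDerivWithinAt ?_
        exact (((hFd (t + h k)).comp_add_const t (h k)).sub (hFd t)).fun_const_smul _⟩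
    exact hc.hasSobolevDeriv.l2Dominated ha.le
  -- Polynomial cutoffs: `θ` is zero at both ends and lies in `(0,1]` inside, so `ρ k` vanishes at
  -- the ends and tends to `1` at every interior point.
  set θ : ℝ → ℝ := fun t => 4 * t * (a - t) / a ^ 2 with hθ
  set ρ : ℕ → ℝ → ℝ := fun k t => 1 - (1 - θ t) ^ (k + 1) with hρ
  have hθ0 : ∀ t ∈ Icc 0 a, 0 ≤ θ t := fun t ht => by
    have := ht.1; have := sub_nonneg.2 ht.2; simp only [hθ]; positivity
  have hθ1 : ∀ t ∈ Icc 0 a, θ t ≤ 1 := fun t ht => by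
    simp only [hθ]; rw [div_le_one (by positivity)]; nlinarith [sq_nonneg (a - 2 * t)]
  have hρd : ∀ k, L2Dominated a (fun t => ((ρ k t : ℝ) : ℂ)) := fun k => by
    have hc : ContDiff ℝ 1 (ρ k) := by simp only [hρ, hθ]; fun_prop
    have hd : Continuous (deriv (ρ k)) := hc.continuous_deriv le_rfl
    have : L2Dominated a (ρ k) := by
      refine L2Dominated.of_primitive ha.le (g := deriv (ρ k)) hd.continuousOn.memLp_two_Icc
        fun t _ => ?_
      rw [intervalIntegral.integral_deriv_eq_sub
        (fun x _ => hc.differentiable one_ne_zero x) (hd.intervalIntegrable _ _)]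
      ring
    exact this.of_norm_sub_le zero_le_one fun s _ t _ _ => by
      rw [one_mul, ← Complex.ofReal_sub, Complex.norm_real]
  have hρ1 : ∀ k, ∀ t ∈ Icc 0 a, |ρ k t| ≤ 1 := fun k t ht => by
    have h1 := hθ0 t ht
    have h2 := hθ1 t ht
    have h3 : 0 ≤ (1 - θ t) ^ (k + 1) := pow_nonneg (by linarith) _
    have h4 : (1 - θ t) ^ (k + 1) ≤ 1 := pow_le_one₀ (by linarith) (by linarith)
    rw [abs_le]; simp only [hρ]; constructor <;> linarith
  have hM0 : 0 ≤ M := (norm_nonneg _).trans (hVM 0)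
  refine ⟨fun k t => ((ρ k t : ℝ) : ℂ) • W k t, M, fun k => ?_, fun k => (hρd k).smul ha.le (hWd k),
    fun k => ?_, fun k => ?_, fun k t ht => ?_, fun t ht => ?_⟩
  · have : Continuous (ρ k) := by simp only [hρ, hθ]; fun_prop
    exact (Complex.continuous_ofReal.comp this).smul (hWc k)
  · simp [hρ, hθ]
  · simp [hρ, hθ]
  · rw [norm_smul, Complex.norm_real, Real.norm_eq_abs]
    calc _ ≤ 1 * M := mul_le_mul (hρ1 k t ht) (hWM k t) (norm_nonneg _) zero_le_one
      _ = M := one_mul M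
  · have hVt : V t = v₁ t := by
      simp only [hV]
      rw [IccExtend_of_mem _ _ (Ioo_subset_Icc_self ht)]; rfl
    have t1 : Tendsto (fun k => W k t) atTop (𝓝 (V t)) := by
      have := hasDerivAt_iff_tendsto_slope_zero.1 (hFd t)
      refine this.comp (tendsto_nhdsWithin_iff.2 ⟨tendsto_one_div_add_atTop_nhds_zero_nat,
        Eventually.of_forall fun k => (hpos k).ne'⟩)
    have t2 : Tendsto (fun k => ρ k t) atTop (𝓝 1) := by
      have hpos' : 0 < θ t := by
        have := ht.1; have := sub_pos.2 ht.2; simp only [hθ]; positivity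
      have := (tendsto_pow_atTop_nhds_zero_of_lt_one
        (sub_nonneg.2 (hθ1 t (Ioo_subset_Icc_self ht))) (by linarith)).comp (tendsto_add_atTop_nat 1)
      simpa [hρ] using this.const_sub 1
    have t3 : Tendsto (fun k => ((ρ k t : ℝ) : ℂ)) atTop (𝓝 ((1 : ℝ) : ℂ)) :=
      (Complex.continuous_ofReal.tendsto 1).comp t2
    have := t3.smul t1
    rwa [Complex.ofReal_one, one_smul, hVt] at this

lemma continuous_cMat_quadratic (B : Matrix (Fin m) (Fin m) ℝ) :
    Continuous fun x : Fin m → ℂ => (cMat B).mulVec x ⬝ᵥ star x := by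
  have h1 : Continuous fun x : Fin m → ℂ => (cMat B).mulVec x :=
    Continuous.matrix_mulVec (A := fun _ => cMat B) continuous_const continuous_id
  exact h1.dotProduct continuous_star

lemma tendsto_sturmDensity (A B C : Matrix (Fin m) (Fin m) ℝ) {x y : ℕ → Fin m → ℂ}
    {u v : Fin m → ℂ} (hx : Tendsto x atTop (𝓝 u)) (hy : Tendsto y atTop (𝓝 v)) :
    Tendsto (fun k => sturmDensity A B C (x k) (y k) (x k) (y k)) atTop
      (𝓝 (sturmDensity A B C u v u v)) := by
  have h1 : ∀ D : Matrix (Fin m) (Fin m) ℝ, Continuous fun x : Fin m → ℂ => (cMat D).mulVec x :=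
    fun D => Continuous.matrix_mulVec (A := fun _ => cMat D) continuous_const continuous_id
  have h2 : ∀ (D : Matrix (Fin m) (Fin m) ℝ) {z : ℕ → Fin m → ℂ} {w : Fin m → ℂ},
      Tendsto z atTop (𝓝 w) → Tendsto (fun k => (cMat D).mulVec (z k)) atTop
        (𝓝 ((cMat D).mulVec w)) := fun D z w hz => ((h1 D).tendsto w).comp hz
  have h3 : ∀ {z z' : ℕ → Fin m → ℂ} {w w' : Fin m → ℂ}, Tendsto z atTop (𝓝 w) →
      Tendsto z' atTop (𝓝 w') → Tendsto (fun k => z k ⬝ᵥ star (z' k)) atTop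
        (𝓝 (w ⬝ᵥ star w')) := fun {z z' w w'} hz hz' => by
    simp only [dotProduct, Pi.star_apply]
    exact tendsto_finsetSum _ fun i _ => (tendsto_pi_nhds.1 hz i).mul
      ((tendsto_pi_nhds.1 hz' i).star)
  exact (h3 ((h2 A hy).add (h2 B hx)) hy).add (h3 ((h2 B.transpose hy).add (h2 C hx)) hx)

/-- The form is nonnegative on all `C¹` functions if it is on the Neumann space. -/
lemma SturmPosDefNeumann.form_nonneg (ha : 0 < a) (h : IsLegendreCoeff P Q R a)
    (hpos : SturmPosDefNeumann P Q R a) {v v₁ : ℝ → Fin m → ℂ} (hv : IsC1Pair a v v₁) :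
    0 ≤ (sturmForm P Q R a v v₁ v v₁).re := by
  obtain ⟨w, M, hwc, hwd, hw0, hwa, hwM, hwt⟩ := exists_tendsto_l2Dominated_of_continuousOn ha hv.1
  -- Primitives of the approximants starting at `v 0`: each satisfies the Neumann conditions, and
  -- they converge to `v` at every point of `[0,a]`, the ends included, so the boundary terms
  -- converge too.
  set V : ℕ → ℝ → Fin m → ℂ := fun k t => v 0 + ∫ s in (0:ℝ)..t, w k s with hV
  have hVd : ∀ k t, HasDerivAt (V k) (w k t) t := fun k t =>
    (intervalIntegral.integral_hasDerivAt_right ((hwc k).intervalIntegrable _ _)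
      ((hwc k).stronglyMeasurableAtFilter _ _) (hwc k).continuousAt).const_add _
  have hVc : ∀ k, IsC1Pair a (V k) (w k) := fun k =>
    ⟨(hwc k).continuousOn, fun t _ => (hVd k t).hasDerivWithinAt⟩
  have hVpos : ∀ k, 0 ≤ (sturmForm P Q R a (V k) (w k) (V k) (w k)).re := fun k =>
    (hpos.form_of_neumann ha h (hVc k) (hwd k) (hw0 k) (hwa k)).2.1
  have hae : ∀ᵐ t : ℝ, t ≠ a := by simp [ae_iff, measure_singleton]
  have hVt : ∀ t ∈ Icc 0 a, Tendsto (fun k => V k t) atTop (𝓝 (v t)) := fun t ht => by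
    rw [hv.hasSobolevDeriv.2 t ht]
    refine Tendsto.const_add _ ?_
    refine intervalIntegral.tendsto_integral_filter_of_dominated_convergence (fun _ => M)
      (Eventually.of_forall fun k => (hwc k).aestronglyMeasurable.restrict)
      (Eventually.of_forall fun k => Eventually.of_forall fun s hs => ?_)
      intervalIntegrable_const ?_
    · rw [uIoc_of_le ht.1] at hs
      exact hwM k s ⟨hs.1.le, hs.2.trans ht.2⟩
    · filter_upwards [hae] with s hsa hs
      rw [uIoc_of_le ht.1] at hs
      exact hwt s ⟨hs.1, lt_of_le_of_ne (hs.2.trans ht.2) hsa⟩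
  have hVM : ∀ k, ∀ t ∈ Icc 0 a, ‖V k t‖ ≤ ‖v 0‖ + M * a := fun k t ht => by
    have := intervalIntegral.norm_integral_le_of_norm_le_const (a := 0) (b := t) (f := w k) (C := M)
      (fun s hs => by
        rw [uIoc_of_le ht.1] at hs
        exact hwM k s ⟨hs.1.le, hs.2.trans ht.2⟩)
    have hM0 : 0 ≤ M := (norm_nonneg _).trans (hwM k t ht)
    rw [sub_zero, abs_of_nonneg ht.1] at this
    refine (norm_add_le _ _).trans ?_
    have := mul_le_mul_of_nonneg_left ht.2 hM0
    linarith
  clear_value V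
  have hq : ∀ b ∈ Icc 0 a, Tendsto (fun k => (cMat (Q b)).mulVec (V k b) ⬝ᵥ star (V k b)) atTop
      (𝓝 ((cMat (Q b)).mulVec (v b) ⬝ᵥ star (v b))) := fun b hb =>
    ((continuous_cMat_quadratic (Q b)).tendsto (v b)).comp (hVt b hb)
  -- All values `(s, V k s, w k s)` lie in one compact set, on which the density is bounded; this is
  -- the majorant for dominated convergence.
  obtain ⟨D, hD⟩ := (isCompact_Icc.prod ((isCompact_closedBall (0 : Fin m → ℂ)
    (‖v 0‖ + M * a)).prod (isCompact_closedBall (0 : Fin m → ℂ) M))).exists_bound_of_continuousOn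
    (h.continuousOn_density (s := Icc 0 a ×ˢ Metric.closedBall (0 : Fin m → ℂ)
      (‖v 0‖ + M * a) ×ˢ Metric.closedBall (0 : Fin m → ℂ) M) (τ := fun x => x.1)
      (v := fun x => x.2.1) (v₁ := fun x => x.2.2) (w := fun x => x.2.1) (w₁ := fun x => x.2.2)
      (by fun_prop) (fun x hx => hx.1) (by fun_prop) (by fun_prop) (by fun_prop) (by fun_prop))
  have hlim : Tendsto (fun k => sturmForm P Q R a (V k) (w k) (V k) (w k)) atTop
      (𝓝 (sturmForm P Q R a v v₁ v v₁)) := by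
    refine Tendsto.sub ?_ ?_
    · refine intervalIntegral.tendsto_integral_filter_of_dominated_convergence (fun _ => D)
        (Eventually.of_forall fun k => ?_)
        (Eventually.of_forall fun k => Eventually.of_forall fun s hs => ?_)
        intervalIntegrable_const ?_
      · exact (h.intervalIntegrable_density ha.le (hVc k) (hVc k)).aestronglyMeasurable_restrict_uIoc
      · rw [uIoc_of_le ha.le] at hs
        have hs' : s ∈ Icc 0 a := ⟨hs.1.le, hs.2⟩
        refine hD (s, V k s, w k s) ⟨hs', ?_, ?_⟩
        · exact mem_closedBall_zero_iff.2 (hVM k s hs')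
        · exact mem_closedBall_zero_iff.2 (hwM k s hs')
      · filter_upwards [hae] with s hsa hs
        rw [uIoc_of_le ha.le] at hs
        have l1 := hVt s ⟨hs.1.le, hs.2⟩
        have l2 := hwt s ⟨hs.1, lt_of_le_of_ne hs.2 hsa⟩
        exact tendsto_sturmDensity (P s) (Q s) (R s) l1 l2
    · exact (hq a ⟨ha.le, le_rfl⟩).sub (hq 0 ⟨le_rfl, ha.le⟩)
  exact ge_of_tendsto' ((Complex.continuous_re.tendsto _).comp hlim) hVpos

end Density

/-! ### Hermitian symmetry of the form, and its null solutions. -/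

section Solution

variable {m : ℕ} {a : ℝ} {P Q R : ℝ → Matrix (Fin m) (Fin m) ℝ}

lemma IsLegendreCoeff.star_integral_density (ha : 0 ≤ a) (h : IsLegendreCoeff P Q R a)
    (v v₁ w w₁ : ℝ → Fin m → ℂ) :
    star (∫ t in (0:ℝ)..a, sturmDensity (P t) (Q t) (R t) (v t) (v₁ t) (w t) (w₁ t)) =
      ∫ t in (0:ℝ)..a, sturmDensity (P t) (Q t) (R t) (w t) (w₁ t) (v t) (v₁ t) := by
  rw [RCLike.star_def, ← intervalIntegral.intervalIntegral_conj]
  refine intervalIntegral.integral_congr fun t ht => ?_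
  rw [uIcc_of_le ha] at ht
  exact star_sturmDensity (h.symmP t ht) (h.symmR t ht) _ _ _ _

/-- On the vector `e_i + i e_j` the imaginary part is `B i j - B j i`. -/
lemma Matrix.transpose_eq_of_im_eq_zero {B : Matrix (Fin m) (Fin m) ℝ}
    (hB : ∀ c : Fin m → ℂ, ((cMat B).mulVec c ⬝ᵥ star c).im = 0) : B.transpose = B := by
  ext i j
  have := hB (Pi.single i 1 + Pi.single j Complex.I)
  simp [Matrix.mulVec_add, dotProduct_add, cMat] at this
  simp only [Matrix.transpose_apply]
  linarith

/-- Reality of `⟨A v, v⟩` on the Neumann space makes `Q` symmetric at the end points. -/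
lemma SturmPosDefNeumann.transpose_Q (ha : 0 < a) (h : IsLegendreCoeff P Q R a)
    (hpos : SturmPosDefNeumann P Q R a) :
    (Q 0).transpose = Q 0 ∧ (Q a).transpose = Q a := by
  have key : ∀ v v₁ : ℝ → Fin m → ℂ, IsC1Pair a v v₁ → L2Dominated a v₁ → v₁ 0 = 0 → v₁ a = 0 →
      ((cMat (Q a)).mulVec (v a) ⬝ᵥ star (v a) -
        (cMat (Q 0)).mulVec (v 0) ⬝ᵥ star (v 0)).im = 0 := by
    intro v v₁ hv hv₁ h0 h1
    have him := (hpos.form_of_neumann ha h hv hv₁ h0 h1).1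
    have hst := congrArg Complex.im (h.star_integral_density ha.le v v₁ v v₁)
    rw [RCLike.star_def, Complex.conj_im] at hst
    rw [sturmForm, Complex.sub_im] at him
    linarith
  have hQ0 : (Q 0).transpose = Q 0 := by
    refine Matrix.transpose_eq_of_im_eq_zero fun c => ?_
    -- The cubic Hermite profile goes from `c` at `0` to zero at `a` with zero slope at both ends,
    -- so only the `Q 0` term survives.
    have hd : ∀ t : ℝ, HasDerivAt (fun t : ℝ => ((1 - 3 * (t / a) ^ 2 + 2 * (t / a) ^ 3 : ℝ) : ℂ) • c)
        (((-6 * t / a ^ 2 + 6 * t ^ 2 / a ^ 3 : ℝ) : ℂ) • c) t := fun t => by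
      have h1 : HasDerivAt (fun t : ℝ => t / a) (1 / a) t := (hasDerivAt_id t).div_const a
      have h2 := (((h1.pow 2).const_mul 3).const_sub 1).add ((h1.pow 3).const_mul 2)
      refine (HasDerivAt.smul_const ?_ c)
      refine HasDerivAt.ofReal_comp ?_
      refine HasDerivAt.congr_deriv h2 ?_
      simp; field_simp; ring
    have hd' : ∀ t : ℝ, HasDerivAt (fun t : ℝ => ((-6 * t / a ^ 2 + 6 * t ^ 2 / a ^ 3 : ℝ) : ℂ) • c)
        (((-6 / a ^ 2 + 12 * t / a ^ 3 : ℝ) : ℂ) • c) t := fun t => by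
      have h2 := (((hasDerivAt_id t).const_mul (-6)).div_const (a ^ 2)).add
        ((((hasDerivAt_id t).pow 2).const_mul 6).div_const (a ^ 3))
      refine (HasDerivAt.smul_const ?_ c)
      refine HasDerivAt.ofReal_comp ?_
      refine HasDerivAt.congr_deriv h2 ?_
      simp; ring
    have hc : IsC1Pair a (fun t : ℝ => ((-6 * t / a ^ 2 + 6 * t ^ 2 / a ^ 3 : ℝ) : ℂ) • c)
        (fun t => ((-6 / a ^ 2 + 12 * t / a ^ 3 : ℝ) : ℂ) • c) :=
      ⟨by fun_prop, fun t _ => (hd' t).hasDerivWithinAt⟩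
    have := key _ _ ⟨hc.continuousOn, fun t _ => (hd t).hasDerivWithinAt⟩
      (hc.hasSobolevDeriv.l2Dominated ha.le) (by simp) (by
        have : -6 * a / a ^ 2 + 6 * a ^ 2 / a ^ 3 = 0 := by field_simp; ring
        rw [this]; simp)
    have ea : 1 - 3 * (a / a) ^ 2 + 2 * (a / a) ^ 3 = 0 := by field_simp; ring
    have e0 : 1 - 3 * (0 / a) ^ 2 + 2 * (0 / a) ^ 3 = 1 := by simp
    rw [ea, e0] at this
    simpa using this
  refine ⟨hQ0, Matrix.transpose_eq_of_im_eq_zero fun c => ?_⟩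
  -- A constant function involves both ends, but the term at `0` is real by the symmetry just
  -- proved.
  have := key (fun _ => c) (fun _ => 0) ⟨continuousOn_const, fun t _ => hasDerivWithinAt_const _ _ _⟩
    (L2Dominated.const 0) rfl rfl
  have h0 := congrArg Complex.im (cMat_mulVec_dotProduct_star (Q 0) c c)
  have h1 := congrArg Complex.im (star_dotProduct_star ((cMat (Q 0)).mulVec c) c)
  rw [hQ0] at h0
  rw [RCLike.star_def, Complex.conj_im] at h1
  rw [Complex.sub_im] at this
  linarith

lemma IsLegendreCoeff.star_sturmForm (ha : 0 ≤ a) (h : IsLegendreCoeff P Q R a)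
    (h0 : (Q 0).transpose = Q 0) (h1 : (Q a).transpose = Q a) (v v₁ w w₁ : ℝ → Fin m → ℂ) :
    star (sturmForm P Q R a v v₁ w w₁) = sturmForm P Q R a w w₁ v v₁ := by
  rw [sturmForm, sturmForm, star_sub, star_sub, h.star_integral_density ha,
    cMat_mulVec_dotProduct_star, cMat_mulVec_dotProduct_star, h0, h1, star_dotProduct_star,
    star_dotProduct_star]

lemma IsC1Pair.add_smul {v v₁ w w₁ : ℝ → Fin m → ℂ} (hv : IsC1Pair a v v₁) (hw : IsC1Pair a w w₁)
    (ε : ℝ) : IsC1Pair a (fun t => v t + ε • w t) (fun t => v₁ t + ε • w₁ t) :=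
  ⟨hv.1.add (hw.1.const_smul ε), fun t ht => (hv.2 t ht).add ((hw.2 t ht).fun_const_smul ε)⟩

lemma IsLegendreCoeff.sturmForm_add_smul (ha : 0 ≤ a) (h : IsLegendreCoeff P Q R a)
    {v v₁ w w₁ : ℝ → Fin m → ℂ} (hv : IsC1Pair a v v₁) (hw : IsC1Pair a w w₁) (ε : ℝ) :
    sturmForm P Q R a (fun t => v t + ε • w t) (fun t => v₁ t + ε • w₁ t)
      (fun t => v t + ε • w t) (fun t => v₁ t + ε • w₁ t) =
    sturmForm P Q R a v v₁ v v₁ +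
      ε * (sturmForm P Q R a v v₁ w w₁ + sturmForm P Q R a w w₁ v v₁) +
      ε ^ 2 * sturmForm P Q R a w w₁ w w₁ := by
  have i1 := h.intervalIntegrable_density ha hv hv
  have i2 := h.intervalIntegrable_density ha hv hw
  have i3 := h.intervalIntegrable_density ha hw hv
  have i4 := h.intervalIntegrable_density ha hw hw
  simp only [sturmForm, sturmDensity_add_smul]
  rw [intervalIntegral.integral_add (i1.add ((i2.add i3).const_mul _)) (i4.const_mul _),
    intervalIntegral.integral_add i1 ((i2.add i3).const_mul _),
    intervalIntegral.integral_const_mul, intervalIntegral.integral_const_mul,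
    intervalIntegral.integral_add i2 i3]
  simp only [← Complex.coe_smul, Matrix.mulVec_add, Matrix.mulVec_smul, star_add,
    star_smul, add_dotProduct, dotProduct_add, smul_dotProduct, dotProduct_smul, smul_eq_mul,
    RCLike.star_def, Complex.conj_ofReal]
  ring

/-- `u` solves the Sturm equation on `s`, with derivative `u₁` and momentum `p`. -/
structure IsSturmSolution (P Q R : ℝ → Matrix (Fin m) (Fin m) ℝ) (s : Set ℝ)
    (u u₁ p : ℝ → Fin m → ℂ) : Prop where
  momentum : ∀ t ∈ s, (cMat (P t)).mulVec (u₁ t) + (cMat (Q t)).mulVec (u t) = p t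
  deriv_u : ∀ t ∈ s, HasDerivWithinAt u (u₁ t) s t
  deriv_p : ∀ t ∈ s,
    HasDerivWithinAt p ((cMat (Q t).transpose).mulVec (u₁ t) + (cMat (R t)).mulVec (u t)) s t

variable {u u₁ p : ℝ → Fin m → ℂ}

lemma IsLegendreCoeff.continuousOn_inv_mulVec (h : IsLegendreCoeff P Q R a) {v : ℝ → Fin m → ℂ}
    (hv : ContinuousOn v (Icc 0 a)) :
    ContinuousOn (fun t => (cMat (P t))⁻¹.mulVec (v t)) (Icc 0 a) := by
  refine continuousOn_pi.2 fun i => ?_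
  simp only [Matrix.mulVec, dotProduct]
  exact continuousOn_finsetSum _ fun j _ => ContinuousOn.mul
    (continuousOn_pi.1 (continuousOn_pi.1 h.continuousOn_inv i) j) (continuousOn_pi.1 hv j)

lemma IsSturmSolution.isC1Pair (h : IsLegendreCoeff P Q R a)
    (hu : IsSturmSolution P Q R (Icc 0 a) u u₁ p) : IsC1Pair a u u₁ := by
  refine ⟨?_, hu.deriv_u⟩
  have h1 : ContinuousOn u (Icc 0 a) := fun t ht => (hu.deriv_u t ht).continuousWithinAt
  have h2 : ContinuousOn p (Icc 0 a) := fun t ht => (hu.deriv_p t ht).continuousWithinAt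
  refine (h.continuousOn_inv_mulVec (h2.sub (h.contQ.cMat_mulVec h1))).congr fun t ht => ?_
  beta_reduce
  rw [Pi.sub_apply, ← hu.momentum t ht, add_sub_cancel_right, h.inv_mulVec ht]

lemma IsSturmSolution.isC1Pair_momentum (h : IsLegendreCoeff P Q R a)
    (hu : IsSturmSolution P Q R (Icc 0 a) u u₁ p) :
    IsC1Pair a p (fun t => (cMat (Q t).transpose).mulVec (u₁ t) + (cMat (R t)).mulVec (u t)) := by
  have hc := hu.isC1Pair h
  refine ⟨ContinuousOn.add ?_ (h.contR.cMat_mulVec hc.continuousOn), hu.deriv_p⟩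
  exact ContinuousOn.cMat_mulVec
    ((Continuous.matrix_transpose continuous_id).comp_continuousOn h.contQ) hc.1

/-- The form of a solution `u` against `w` is a boundary term. -/
lemma IsSturmSolution.sturmForm_eq (ha : 0 ≤ a) (h : IsLegendreCoeff P Q R a)
    (hu : IsSturmSolution P Q R (Icc 0 a) u u₁ p) {w w₁ : ℝ → Fin m → ℂ} (hw : IsC1Pair a w w₁) :
    sturmForm P Q R a u u₁ w w₁ = (cMat (P a)).mulVec (u₁ a) ⬝ᵥ star (w a) -
      (cMat (P 0)).mulVec (u₁ 0) ⬝ᵥ star (w 0) := by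
  obtain ⟨i1, i2, e⟩ := (hu.isC1Pair_momentum h).hasSobolevDeriv.integral_dotProduct_star ha
    hw.hasSobolevDeriv
  have : ∫ t in (0:ℝ)..a, sturmDensity (P t) (Q t) (R t) (u t) (u₁ t) (w t) (w₁ t) =
      p a ⬝ᵥ star (w a) - p 0 ⬝ᵥ star (w 0) := by
    rw [← e, ← intervalIntegral.integral_add i1 i2]
    refine intervalIntegral.integral_congr fun t ht => ?_
    rw [uIcc_of_le ha] at ht
    simp only [sturmDensity, hu.momentum t ht]
    rw [add_comm]
  rw [sturmForm, this, ← hu.momentum a ⟨ha, le_rfl⟩, ← hu.momentum 0 ⟨le_rfl, ha⟩,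
    add_dotProduct, add_dotProduct]
  ring

lemma eq_zero_of_forall_nonneg_quadratic {b c : ℝ} (h : ∀ ε : ℝ, 0 ≤ ε * b + ε ^ 2 * c) : b = 0 := by
  have hc : 0 ≤ c := by have h1 := h 1; have h2 := h (-1); nlinarith
  -- Near the minimiser `-b / (2c)`, with `c + 1` in the denominator to allow `c = 0`; the value is
  -- `-b² / (c+1)²`.
  have := h (-b / (c + 1))
  have e : -b / (c + 1) * b + (-b / (c + 1)) ^ 2 * c = - (b ^ 2 / (c + 1) ^ 2) := by
    field_simp; ring
  rw [e] at this
  have h2 : b ^ 2 / (c + 1) ^ 2 ≤ 0 := by linarith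
  have h3 : b ^ 2 / (c + 1) ^ 2 = 0 := le_antisymm h2 (by positivity)
  have h4 : (c + 1) ^ 2 ≠ 0 := by positivity
  have := (div_eq_zero_iff.1 h3).resolve_right h4
  exact pow_eq_zero_iff two_ne_zero |>.1 this

lemma re_dotProduct_star_self_nonneg (v : Fin m → ℂ) : 0 ≤ (v ⬝ᵥ star v).re := by
  simp only [dotProduct, Pi.star_apply, RCLike.star_def, Complex.mul_conj, Complex.re_sum,
    Complex.ofReal_re]
  exact Finset.sum_nonneg fun i _ => Complex.normSq_nonneg _

lemma eq_zero_of_re_dotProduct_star_self {v : Fin m → ℂ} (h : (v ⬝ᵥ star v).re = 0) : v = 0 := by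
  simp only [dotProduct, Pi.star_apply, RCLike.star_def, Complex.mul_conj, Complex.re_sum,
    Complex.ofReal_re] at h
  rw [Finset.sum_eq_zero_iff_of_nonneg fun i _ => Complex.normSq_nonneg _] at h
  ext i
  exact Complex.normSq_eq_zero.1 (h i (Finset.mem_univ i))

/-- The boundary term of a solution is nonnegative; if it vanishes, so does `P u'` at both ends. -/
lemma IsSturmSolution.boundary_nonneg (ha : 0 < a) (h : IsLegendreCoeff P Q R a)
    (hpos : SturmPosDefNeumann P Q R a) (hu : IsSturmSolution P Q R (Icc 0 a) u u₁ p) :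
    0 ≤ (sturmForm P Q R a u u₁ u u₁).re ∧ ((sturmForm P Q R a u u₁ u u₁).re = 0 →
      (cMat (P 0)).mulVec (u₁ 0) = 0 ∧ (cMat (P a)).mulVec (u₁ a) = 0) := by
  have hc := hu.isC1Pair h
  refine ⟨hpos.form_nonneg ha h hc, fun hz => ?_⟩
  obtain ⟨hQ0, hQa⟩ := hpos.transpose_Q ha h
  set α := (cMat (P 0)).mulVec (u₁ 0) with hα
  set β := (cMat (P a)).mulVec (u₁ a) with hβ
  -- Affine interpolation from `-α` to `β`, chosen so that the boundary term of `u` against `w` is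
  -- `|β|² + |α|²`.
  set w : ℝ → Fin m → ℂ := fun t => -α + (t / a) • (β + α) with hw
  have hwd : IsC1Pair a w (fun _ => (1 / a) • (β + α)) := by
    refine ⟨continuousOn_const, fun t _ => HasDerivAt.hasDerivWithinAt ?_⟩
    exact (((hasDerivAt_id t).div_const a).smul_const _).const_add _
  have w0 : w 0 = -α := by simp [hw]
  have wa : w a = β := by simp [hw, div_self ha.ne']
  have hX : sturmForm P Q R a u u₁ w (fun _ => (1 / a) • (β + α)) =
      β ⬝ᵥ star β + α ⬝ᵥ star α := by
    rw [hu.sturmForm_eq ha.le h hwd, w0, wa, star_neg, dotProduct_neg, sub_neg_eq_add]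
  have hq : ∀ ε : ℝ, 0 ≤ ε * (2 * (β ⬝ᵥ star β + α ⬝ᵥ star α).re) +
      ε ^ 2 * (sturmForm P Q R a w (fun _ => (1 / a) • (β + α)) w
        (fun _ => (1 / a) • (β + α))).re := fun ε => by
    have := hpos.form_nonneg ha h (hc.add_smul hwd ε)
    rw [h.sturmForm_add_smul ha.le hc hwd, ← h.star_sturmForm ha.le hQ0 hQa u u₁ w, hX,
      Complex.add_re, Complex.add_re, hz, zero_add, Complex.re_ofReal_mul,
      ← Complex.ofReal_pow, Complex.re_ofReal_mul, Complex.add_re, RCLike.star_def,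
      Complex.conj_re, ← two_mul] at this
    exact this
  have := eq_zero_of_forall_nonneg_quadratic hq
  rw [Complex.add_re] at this
  have h1 := re_dotProduct_star_self_nonneg α
  have h2 := re_dotProduct_star_self_nonneg β
  exact ⟨eq_zero_of_re_dotProduct_star_self (by linarith),
    eq_zero_of_re_dotProduct_star_self (by linarith)⟩

end Solution

/-! ### Regularity of `P`, `Q` and of null solutions, from the domain of the operator. -/

section Regularity

variable {m : ℕ} {a : ℝ} {P Q R : ℝ → Matrix (Fin m) (Fin m) ℝ} {u u₁ p : ℝ → Fin m → ℂ}

lemma exists_mulVec_bound {A : ℝ → Matrix (Fin m) (Fin m) ℂ} (hA : ContinuousOn A (Icc 0 a)) :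
    ∃ C, 0 ≤ C ∧ ∀ t ∈ Icc 0 a, ∀ v : Fin m → ℂ, ‖(A t).mulVec v‖ ≤ C * ‖v‖ := by
  have hc : ∀ i j, ∃ C, ∀ t ∈ Icc 0 a, ‖A t i j‖ ≤ C := fun i j =>
    isCompact_Icc.exists_bound_of_continuousOn (continuousOn_pi.1 (continuousOn_pi.1 hA i) j)
  choose C hC using hc
  have hC0 : ∀ i j, 0 ≤ max (C i j) 0 := fun i j => le_max_right _ _
  refine ⟨∑ i, ∑ j, max (C i j) 0, Finset.sum_nonneg fun i _ => Finset.sum_nonneg fun j _ => hC0 i j,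
    fun t ht v => ?_⟩
  refine (pi_norm_le_iff_of_nonneg (mul_nonneg (Finset.sum_nonneg fun i _ =>
    Finset.sum_nonneg fun j _ => hC0 i j) (norm_nonneg v))).2 fun i => ?_
  calc ‖(A t).mulVec v i‖ ≤ ∑ j, ‖A t i j * v j‖ :=
        norm_sum_le Finset.univ fun j => A t i j * v j
    _ ≤ ∑ j, max (C i j) 0 * ‖v‖ := Finset.sum_le_sum fun j _ => by
        rw [norm_mul]
        exact mul_le_mul ((hC i j t ht).trans (le_max_left _ _)) (norm_le_pi_norm v j)
          (norm_nonneg _) (hC0 i j)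
    _ = (∑ j, max (C i j) 0) * ‖v‖ := by rw [Finset.sum_mul]
    _ ≤ _ := mul_le_mul_of_nonneg_right (Finset.single_le_sum
        (f := fun i => ∑ j, max (C i j) 0) (fun i _ => Finset.sum_nonneg fun j _ => hC0 i j)
        (Finset.mem_univ i)) (norm_nonneg v)

lemma mulVec_eq_sum_smul (A : Matrix (Fin m) (Fin m) ℂ) (v : Fin m → ℂ) :
    A.mulVec v = ∑ j, v j • A.mulVec (Pi.single j 1) := by
  ext i
  simp [Matrix.mulVec, dotProduct, mul_comm]

lemma L2Dominated.apply {g : ℝ → Fin m → ℂ} (hg : L2Dominated a g) (j : Fin m) :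
    L2Dominated a fun t => g t j :=
  hg.of_norm_sub_le zero_le_one fun s _ t _ _ => by
    rw [one_mul, ← Pi.sub_apply]; exact norm_le_pi_norm _ j

lemma L2Dominated.pi {E : Type*} [NormedAddCommGroup E] {g : Fin m → ℝ → E}
    (hg : ∀ j, L2Dominated a (g j)) : L2Dominated a fun t j => g j t := by
  have h1 : ∀ j, L2Dominated a fun t => (Pi.single j (g j t) : Fin m → E) := fun j =>
    (hg j).of_norm_sub_le zero_le_one fun s _ t _ _ => by
      rw [one_mul, ← Pi.single_sub, Pi.norm_single]
  refine (L2Dominated.sum Finset.univ fun j _ => h1 j).congr fun t _ => ?_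
  ext j; simp [Finset.sum_apply, Pi.single_apply]

lemma exists_isC1Pair (ha : 0 < a) {v₁ : ℝ → Fin m → ℂ} (hv₁ : ContinuousOn v₁ (Icc 0 a)) :
    ∃ v, IsC1Pair a v v₁ := by
  have hVc : Continuous (IccExtend ha.le (domRestrict (Icc 0 a) v₁)) :=
    hv₁.domRestrict.Icc_extend'
  refine ⟨fun t => ∫ s in (0:ℝ)..t, IccExtend ha.le (domRestrict (Icc 0 a) v₁) s, hv₁,
    fun t ht => ?_⟩
  have := intervalIntegral.integral_hasDerivAt_right (hVc.intervalIntegrable 0 t)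
      (hVc.stronglyMeasurableAtFilter _ _) hVc.continuousAt
  rw [IccExtend_of_mem _ _ ht] at this
  exact this.hasDerivWithinAt

/-- If the Sturm operator is defined on the Neumann space, the columns of `Q` are in `W^{1,2}`. -/
lemma SturmPosDefNeumann.l2Dominated_Q (ha : 0 < a) (h : IsLegendreCoeff P Q R a)
    (hpos : SturmPosDefNeumann P Q R a) {v : ℝ → Fin m → ℂ} (hv : L2Dominated a v) :
    L2Dominated a fun t => (cMat (Q t)).mulVec (v t) := by
  -- Constants are Neumann functions, and the momentum of `c` is `Q c`.
  have h1 : ∀ c : Fin m → ℂ, L2Dominated a fun t => (cMat (Q t)).mulVec c := fun c => by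
    have := (hpos.form_of_neumann ha h (v := fun _ => c) (v₁ := fun _ => 0)
      ⟨continuousOn_const, fun t _ => hasDerivWithinAt_const _ _ _⟩ (L2Dominated.const 0) rfl rfl).2.2.2
    simpa using this
  refine (L2Dominated.sum Finset.univ fun j _ => (hv.apply j).smul ha.le
    (h1 (Pi.single j 1))).congr fun t _ => mulVec_eq_sum_smul _ _

/-- If the Sturm operator is defined on the Neumann space, multiplication by `P` maps
`W^{1,2}` functions vanishing at the end points to `W^{1,2}`. -/
lemma SturmPosDefNeumann.l2Dominated_P (ha : 0 < a) (h : IsLegendreCoeff P Q R a)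
    (hpos : SturmPosDefNeumann P Q R a) {g : ℝ → Fin m → ℂ} (hg : L2Dominated a g)
    (h0 : g 0 = 0) (h1 : g a = 0) :
    L2Dominated a fun t => (cMat (P t)).mulVec (g t) := by
  -- A primitive `v` of `g` is a Neumann function with momentum `P g + Q v`, and `Q v` is already
  -- known to be in `W^{1,2}`.
  obtain ⟨v, hv⟩ := exists_isC1Pair ha (hg.continuousOn ha.le)
  have := (hpos.form_of_neumann ha h hv hg h0 h1).2.2.2.sub
    (hpos.l2Dominated_Q ha h (hv.hasSobolevDeriv.l2Dominated ha.le))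
  simpa using this

/-- A `W^{1,2}` function vanishing at both end points is dominated by a nonnegative scalar
`W^{1,2}` function vanishing at both end points. -/
lemma L2Dominated.exists_scalar_majorant (ha : 0 < a) {E : Type*} [NormedAddCommGroup E]
    {f : ℝ → E} (hf : L2Dominated a f) (h0 : f 0 = 0) (h1 : f a = 0) :
    ∃ (φ : ℝ → ℝ) (C : ℝ), 0 ≤ C ∧ L2Dominated a φ ∧ φ 0 = 0 ∧ φ a = 0 ∧
      ∀ t ∈ Icc 0 a, 0 ≤ φ t ∧ ‖f t‖ ≤ C * φ t := by
  obtain ⟨k, k0, hk, hfk⟩ := hf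
  -- Adding `1` guarantees `F a > 0`, even when `k` vanishes.
  have hk1 : MemLp (fun t => k t + 1) 2 (volume.restrict (Icc 0 a)) := hk.add (memLp_const 1)
  have z : (0:ℝ) ∈ Icc 0 a := ⟨le_rfl, ha.le⟩
  have az : a ∈ Icc 0 a := ⟨ha.le, le_rfl⟩
  have ii : ∀ s ∈ Icc 0 a, ∀ t ∈ Icc 0 a, IntervalIntegrable (fun t => k t + 1) volume s t :=
    fun s hs t ht => MemLp.intervalIntegrable_of_mem_Icc hk1 hs ht
  have ik : ∀ s ∈ Icc 0 a, ∀ t ∈ Icc 0 a, IntervalIntegrable k volume s t :=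
    fun s hs t ht => MemLp.intervalIntegrable_of_mem_Icc hk hs ht
  set F : ℝ → ℝ := fun t => ∫ s in (0:ℝ)..t, (k s + 1) with hF
  have hFd : L2Dominated a F :=
    L2Dominated.of_primitive ha.le hk1 fun t _ => by simp [hF]
  have hF0 : F 0 = 0 := by simp [hF]
  have hsub : ∀ s ∈ Icc 0 a, ∀ t ∈ Icc 0 a, F t - F s = (∫ r in s..t, k r) + (t - s) :=
    fun s hs t ht => by
      simp only [hF]
      rw [intervalIntegral.integral_interval_sub_left (ii 0 z t ht) (ii 0 z s hs),
        intervalIntegral.integral_add (ik s hs t ht) intervalIntegrable_const]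
      simp
  have hfF : ∀ s ∈ Icc 0 a, ∀ t ∈ Icc 0 a, s ≤ t → ‖f t - f s‖ ≤ F t - F s :=
    fun s hs t ht hst => by
      rw [hsub s hs t ht]
      linarith [hfk s hs t ht hst]
  have hFa : 0 < F a := by
    have := hsub 0 z a az
    have h2 : 0 ≤ ∫ r in (0:ℝ)..a, k r := intervalIntegral.integral_nonneg ha.le fun r _ => k0 r
    rw [hF0] at this
    linarith
  -- Both `F` and `F a - F` bound `‖f‖`, since `f` vanishes at each end; hence `‖f‖ F(a) = ‖f‖ F +
  -- ‖f‖ (F(a) - F) ≤ 2 F (F(a) - F)`.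
  refine ⟨fun t => F t * (F a - F t), 2 / F a, by positivity, ?_, by simp [hF0], by simp,
    fun t ht => ?_⟩
  · exact hFd.smul ha.le ((L2Dominated.const (F a)).sub hFd)
  · have e1 := hfF 0 z t ht ht.1
    have e2 := hfF t ht a az ht.2
    rw [h0, sub_zero, hF0, sub_zero] at e1
    rw [h1, zero_sub, norm_neg] at e2
    have n := norm_nonneg (f t)
    refine ⟨mul_nonneg (n.trans e1) (n.trans e2), ?_⟩
    rw [div_mul_eq_mul_div, le_div_iff₀ hFa]
    nlinarith [mul_le_mul_of_nonneg_right e1 (n.trans e2), mul_le_mul_of_nonneg_right e2 (n.trans e1)]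

/-- If `P g` is in `W^{1,2}` and vanishes at the end points, then `g` is in `W^{1,2}`. -/
lemma SturmPosDefNeumann.l2Dominated_of_P (ha : 0 < a) (h : IsLegendreCoeff P Q R a)
    (hpos : SturmPosDefNeumann P Q R a) {g : ℝ → Fin m → ℂ}
    (hg : L2Dominated a fun t => (cMat (P t)).mulVec (g t))
    (h0 : (cMat (P 0)).mulVec (g 0) = 0) (h1 : (cMat (P a)).mulVec (g a) = 0) :
    L2Dominated a g := by
  obtain ⟨φ, C, hC, hφ, φ0, φa, hφC⟩ := hg.exists_scalar_majorant ha h0 h1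
  obtain ⟨C₁, hC₁, hP₁⟩ := exists_mulVec_bound h.continuousOn_inv
  obtain ⟨C₂, hC₂, hP₂⟩ := exists_mulVec_bound (A := fun t => cMat (P t))
    (continuous_cMat.comp_continuousOn h.contP)
  have hφc : L2Dominated a fun t => (φ t : ℂ) := hφ.of_norm_sub_le zero_le_one fun s _ t _ _ => by
    rw [one_mul, ← Complex.ofReal_sub, Complex.norm_real]
  -- `P` alone need not be in `W^{1,2}` up to the ends, but `φ P` is, because `φ e_j` vanishes
  -- there. The majorant `φ` then compensates for increments of `P` multiplied by `g`.
  have hΦ : ∀ j : Fin m, L2Dominated a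
      fun t => (φ t : ℂ) • (cMat (P t)).mulVec (Pi.single j 1) := fun j => by
    have := hpos.l2Dominated_P ha h (g := fun t => (φ t : ℂ) • (Pi.single j 1 : Fin m → ℂ))
      (hφc.smul ha.le (L2Dominated.const _)) (by simp [φ0]) (by simp [φa])
    simpa only [Matrix.mulVec_smul] using this
  set Φ : ℝ → Fin m → Fin m → ℂ := fun t j => (φ t : ℂ) • (cMat (P t)).mulVec (Pi.single j 1) with hΦd
  have hΨ : L2Dominated a fun t => (Φ t, φ t) :=
    (L2Dominated.pi hΦ).of_norm_sub_le_add hφ zero_le_one fun s _ t _ _ => by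
      rw [one_mul]
      exact max_le (le_add_of_nonneg_right (norm_nonneg _)) (le_add_of_nonneg_left (norm_nonneg _))
  refine hg.of_norm_sub_le_add hΨ (C := C₁ * (1 + m * (C₁ * C * (1 + C₂)))) (by positivity)
    fun s hs t ht _ => ?_
  -- `P(t)(g(t) - g(s)) = (P g)(t) - (P g)(s) - (P(t) - P(s)) g(s)`. In the last term `g(s)` is
  -- bounded by a multiple of `φ(s)`.
  have e1 : (cMat (P t)).mulVec (g t - g s) = ((cMat (P t)).mulVec (g t) -
      (cMat (P s)).mulVec (g s)) - ∑ j, g s j • ((cMat (P t)).mulVec (Pi.single j 1) -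
        (cMat (P s)).mulVec (Pi.single j 1)) := by
    simp only [smul_sub, Finset.sum_sub_distrib]
    rw [← mulVec_eq_sum_smul, ← mulVec_eq_sum_smul, Matrix.mulVec_sub]
    abel
  have e2 : ‖g t - g s‖ ≤ C₁ * ‖(cMat (P t)).mulVec (g t - g s)‖ := by
    have := hP₁ t ht ((cMat (P t)).mulVec (g t - g s))
    rwa [h.inv_mulVec ht] at this
  have e3 : ∀ j, ‖g s j‖ ≤ C₁ * C * φ s := fun j => by
    have := hP₁ s hs ((cMat (P s)).mulVec (g s))
    rw [h.inv_mulVec hs] at this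
    calc ‖g s j‖ ≤ ‖g s‖ := norm_le_pi_norm _ j
      _ ≤ C₁ * ‖(cMat (P s)).mulVec (g s)‖ := this
      _ ≤ C₁ * (C * φ s) := mul_le_mul_of_nonneg_left (hφC s hs).2 hC₁
      _ = _ := by ring
  -- Discrete Leibniz rule: `φ(s)(P(t) - P(s))` is the increment of `φ P` minus `(φ(t) - φ(s))
  -- P(t)`.
  have e4 : ∀ j, φ s * ‖(cMat (P t)).mulVec (Pi.single j 1) - (cMat (P s)).mulVec (Pi.single j 1)‖ ≤
      (1 + C₂) * ‖(Φ t, φ t) - (Φ s, φ s)‖ := fun j => by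
    have n1 : ‖Φ t j - Φ s j‖ ≤ ‖(Φ t, φ t) - (Φ s, φ s)‖ :=
      (norm_le_pi_norm (Φ t - Φ s) j).trans (norm_fst_le ((Φ t, φ t) - (Φ s, φ s)))
    have n2 : |φ t - φ s| ≤ ‖(Φ t, φ t) - (Φ s, φ s)‖ :=
      norm_snd_le ((Φ t, φ t) - (Φ s, φ s))
    have n3 : ‖(cMat (P t)).mulVec (Pi.single j 1)‖ ≤ C₂ := by
      have := hP₂ t ht (Pi.single j 1)
      rwa [Pi.norm_single, norm_one, mul_one] at this
    have n4 : (φ s : ℂ) • ((cMat (P t)).mulVec (Pi.single j 1) -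
        (cMat (P s)).mulVec (Pi.single j 1)) = (Φ t j - Φ s j) -
          ((φ t - φ s : ℝ) : ℂ) • (cMat (P t)).mulVec (Pi.single j 1) := by
      simp only [hΦd, smul_sub, Complex.ofReal_sub, sub_smul]; abel
    have n5 := congrArg norm n4
    rw [norm_smul, Complex.norm_real, Real.norm_of_nonneg (hφC s hs).1] at n5
    rw [n5]
    refine (norm_sub_le _ _).trans ?_
    rw [norm_smul, Complex.norm_real, Real.norm_eq_abs]
    have := mul_le_mul n2 n3 (norm_nonneg _) (norm_nonneg _)
    linarith
  have e5 : ‖∑ j, g s j • ((cMat (P t)).mulVec (Pi.single j 1) -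
        (cMat (P s)).mulVec (Pi.single j 1))‖ ≤
      m * (C₁ * C * (1 + C₂)) * ‖(Φ t, φ t) - (Φ s, φ s)‖ := by
    calc _ ≤ ∑ _j : Fin m, C₁ * C * (1 + C₂) * ‖(Φ t, φ t) - (Φ s, φ s)‖ := by
          refine norm_sum_le_of_le _ fun j _ => ?_
          rw [norm_smul]
          calc _ ≤ C₁ * C * φ s * ‖(cMat (P t)).mulVec (Pi.single j 1) -
                (cMat (P s)).mulVec (Pi.single j 1)‖ :=
                mul_le_mul_of_nonneg_right (e3 j) (norm_nonneg _)
            _ ≤ C₁ * C * ((1 + C₂) * ‖(Φ t, φ t) - (Φ s, φ s)‖) := by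
                rw [mul_assoc]; exact mul_le_mul_of_nonneg_left (e4 j) (by positivity)
            _ = _ := by ring
      _ = _ := by simp; ring
  rw [e1] at e2
  refine e2.trans ?_
  rw [mul_assoc]
  refine mul_le_mul_of_nonneg_left ((norm_sub_le _ _).trans ?_) hC₁
  have n6 := norm_nonneg ((Φ t, φ t) - (Φ s, φ s))
  have n7 := norm_nonneg ((cMat (P t)).mulVec (g t) - (cMat (P s)).mulVec (g s))
  have n8 : 0 ≤ m * (C₁ * C * (1 + C₂)) := by positivity
  nlinarith [mul_nonneg n8 n7]

/-- A solution whose boundary term vanishes is identically zero. -/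
lemma IsSturmSolution.eq_zero_of_boundary_eq_zero (ha : 0 < a) (h : IsLegendreCoeff P Q R a)
    (hpos : SturmPosDefNeumann P Q R a) (hu : IsSturmSolution P Q R (Icc 0 a) u u₁ p)
    (hz : (sturmForm P Q R a u u₁ u u₁).re = 0) : ∀ t ∈ Icc 0 a, u t = 0 := by
  have hc := hu.isC1Pair h
  obtain ⟨h0, h1⟩ := (hu.boundary_nonneg ha h hpos).2 hz
  -- `P u' = p - Q u` is a difference of `W^{1,2}` functions and vanishes at the ends, so `u'` is in
  -- `W^{1,2}` and `u` is in the Neumann space.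
  have hf : L2Dominated a fun t => (cMat (P t)).mulVec (u₁ t) := by
    refine (((hu.isC1Pair_momentum h).hasSobolevDeriv.l2Dominated ha.le).sub
      (hpos.l2Dominated_Q ha h (hc.hasSobolevDeriv.l2Dominated ha.le))).congr fun t ht => ?_
    rw [← hu.momentum t ht, add_sub_cancel_right]
  have hu₁ := hpos.l2Dominated_of_P ha h hf h0 h1
  have e : ∀ t ∈ Icc 0 a, (cMat (P t)).mulVec (u₁ t) = 0 → u₁ t = 0 := fun t ht hP => by
    rw [← h.inv_mulVec ht (u₁ t), hP, Matrix.mulVec_zero]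
  have := (hpos.form_of_neumann ha h hc hu₁ (e 0 ⟨le_rfl, ha.le⟩ h0) (e a ⟨ha.le, le_rfl⟩ h1)).2.2.1
  by_contra hne
  push Not at hne
  exact (this hne).ne' hz

end Regularity

/-! ### Second derivatives of the Lagrangian and their transformation under symmetries. -/

section Coefficients

variable {m : ℕ} {T : ℝ}

lemma uniqueDiffOn_Icc_prod_univ (hT : 0 < T) :
    UniqueDiffOn ℝ (Icc 0 T ×ˢ (univ : Set ((Fin m → ℝ) × (Fin m → ℝ)))) :=
  (uniqueDiffOn_Icc hT).prod uniqueDiffOn_univ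

/-- `L` is regular only on the slab over `[0,T]`, so joint regularity is stated through derivatives
within it. Directions in `q` and `v` stay in the slab, and there the one-sided and ordinary notions
agree even at `t = 0` and `t = T`. -/
lemma partialQ_eq_fderivWithin {G : ℝ → (Fin m → ℝ) → (Fin m → ℝ) → ℝ}
    (hG : DifferentiableOn ℝ (fun p : ℝ × (Fin m → ℝ) × (Fin m → ℝ) => G p.1 p.2.1 p.2.2)
      (Icc 0 T ×ˢ univ)) {t : ℝ} (ht : t ∈ Icc 0 T) (q v : Fin m → ℝ) (i : Fin m) :
    partialQ G t q v i =
      fderivWithin ℝ (fun p : ℝ × (Fin m → ℝ) × (Fin m → ℝ) => G p.1 p.2.1 p.2.2)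
        (Icc 0 T ×ˢ univ) (t, q, v) (0, Pi.single i 1, 0) := by
  have h1 := (hG (t, q, v) ⟨ht, trivial⟩).hasFDerivWithinAt
  have h2 : HasFDerivWithinAt (fun y : Fin m → ℝ => (t, y, v)) _ univ q :=
    ((hasFDerivAt_prodMk_right (𝕜 := ℝ) t (q, v)).comp q
      (hasFDerivAt_prodMk_left q v)).hasFDerivWithinAt
  have hm : MapsTo (fun y : Fin m → ℝ => (t, y, v)) univ
      (Icc 0 T ×ˢ (univ : Set ((Fin m → ℝ) × (Fin m → ℝ)))) := fun y _ => ⟨ht, trivial⟩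
  have h3 := (HasFDerivWithinAt.comp q h1 h2 hm).hasFDerivAt Filter.univ_mem
  rw [partialQ]
  exact congrArg (fun ℓ : (Fin m → ℝ) →L[ℝ] ℝ => ℓ (Pi.single i 1)) h3.fderiv

lemma partialV_eq_fderivWithin {G : ℝ → (Fin m → ℝ) → (Fin m → ℝ) → ℝ}
    (hG : DifferentiableOn ℝ (fun p : ℝ × (Fin m → ℝ) × (Fin m → ℝ) => G p.1 p.2.1 p.2.2)
      (Icc 0 T ×ˢ univ)) {t : ℝ} (ht : t ∈ Icc 0 T) (q v : Fin m → ℝ) (i : Fin m) :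
    partialV G t q v i =
      fderivWithin ℝ (fun p : ℝ × (Fin m → ℝ) × (Fin m → ℝ) => G p.1 p.2.1 p.2.2)
        (Icc 0 T ×ˢ univ) (t, q, v) (0, 0, Pi.single i 1) := by
  have h1 := (hG (t, q, v) ⟨ht, trivial⟩).hasFDerivWithinAt
  have h2 : HasFDerivWithinAt (fun y : Fin m → ℝ => (t, q, y)) _ univ v :=
    ((hasFDerivAt_prodMk_right (𝕜 := ℝ) t (q, v)).comp v
      (hasFDerivAt_prodMk_right q v)).hasFDerivWithinAt
  have hm : MapsTo (fun y : Fin m → ℝ => (t, q, y)) univ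
      (Icc 0 T ×ˢ (univ : Set ((Fin m → ℝ) × (Fin m → ℝ)))) := fun y _ => ⟨ht, trivial⟩
  have h3 := (HasFDerivWithinAt.comp v h1 h2 hm).hasFDerivAt Filter.univ_mem
  rw [partialV]
  exact congrArg (fun ℓ : (Fin m → ℝ) →L[ℝ] ℝ => ℓ (Pi.single i 1)) h3.fderiv

/-- A function of `(t, q, v)` that is `C^k` on `[0,T]`. -/
def IsSmoothLagrangian (T : ℝ) (k : WithTop ℕ∞) (G : ℝ → (Fin m → ℝ) → (Fin m → ℝ) → ℝ) : Prop :=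
  ContDiffOn ℝ k (fun p : ℝ × (Fin m → ℝ) × (Fin m → ℝ) => G p.1 p.2.1 p.2.2) (Icc 0 T ×ˢ univ)

variable {L G : ℝ → (Fin m → ℝ) → (Fin m → ℝ) → ℝ} {k : WithTop ℕ∞}

lemma IsSmoothLagrangian.partialQ (hT : 0 < T) (hG : IsSmoothLagrangian T (k + 1) G) (i : Fin m) :
    IsSmoothLagrangian T k fun t q v => partialQ G t q v i := by
  have h := (ContDiffOn.fderivWithin hG (uniqueDiffOn_Icc_prod_univ hT) le_rfl).clm_apply
    (contDiffOn_const (c := ((0 : ℝ), (Pi.single i 1 : Fin m → ℝ), (0 : Fin m → ℝ))))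
  refine h.congr fun p hp => ?_
  exact partialQ_eq_fderivWithin (hG.differentiableOn (by simp)) hp.1 _ _ _

lemma IsSmoothLagrangian.partialV (hT : 0 < T) (hG : IsSmoothLagrangian T (k + 1) G) (i : Fin m) :
    IsSmoothLagrangian T k fun t q v => partialV G t q v i := by
  have h := (ContDiffOn.fderivWithin hG (uniqueDiffOn_Icc_prod_univ hT) le_rfl).clm_apply
    (contDiffOn_const (c := ((0 : ℝ), (0 : Fin m → ℝ), (Pi.single i 1 : Fin m → ℝ))))
  refine h.congr fun p hp => ?_
  exact partialV_eq_fderivWithin (hG.differentiableOn (by simp)) hp.1 _ _ _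

lemma IsSmoothLagrangian.contDiff_q (hG : IsSmoothLagrangian T k G) {t : ℝ} (ht : t ∈ Icc 0 T)
    (v : Fin m → ℝ) : ContDiff ℝ k fun q => G t q v := by
  rw [← contDiffOn_univ]
  exact ContDiffOn.comp (g := fun p : ℝ × (Fin m → ℝ) × (Fin m → ℝ) => G p.1 p.2.1 p.2.2)
    (f := fun q => (t, q, v)) hG (by fun_prop) fun y _ => ⟨ht, trivial⟩

lemma IsSmoothLagrangian.contDiff_v (hG : IsSmoothLagrangian T k G) {t : ℝ} (ht : t ∈ Icc 0 T)
    (q : Fin m → ℝ) : ContDiff ℝ k fun v => G t q v := by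
  rw [← contDiffOn_univ]
  exact ContDiffOn.comp (g := fun p : ℝ × (Fin m → ℝ) × (Fin m → ℝ) => G p.1 p.2.1 p.2.2)
    (f := fun v => (t, q, v)) hG (by fun_prop) fun y _ => ⟨ht, trivial⟩

lemma IsSmoothLagrangian.continuousOn_comp (hG : IsSmoothLagrangian T 0 G)
    {x y : ℝ → Fin m → ℝ} (hx : Continuous x) (hy : Continuous y) :
    ContinuousOn (fun t => G t (x t) (y t)) (Icc 0 T) :=
  ContinuousOn.comp (g := fun p : ℝ × (Fin m → ℝ) × (Fin m → ℝ) => G p.1 p.2.1 p.2.2)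
    (f := fun t => (t, x t, y t)) hG.continuousOn (by fun_prop) fun t ht => ⟨ht, trivial⟩

lemma fderiv_fderiv_apply_comm {f : (Fin m → ℝ) → ℝ} (hf : ContDiff ℝ 2 f) (x a b : Fin m → ℝ) :
    fderiv ℝ (fun y => fderiv ℝ f y a) x b = fderiv ℝ (fun y => fderiv ℝ f y b) x a := by
  have hd : DifferentiableAt ℝ (fderiv ℝ f) x :=
    (hf.fderiv_right (m := 1) le_rfl).differentiable one_ne_zero x
  rw [fderiv_clm_apply hd (differentiableAt_const a), fderiv_clm_apply hd (differentiableAt_const b)]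
  simpa using (hf.contDiffAt.isSymmSndFDerivAt (by simp)).eq b a

lemma isLegendreCoeff_coeff (hT : 0 < T) (hL : IsSmoothLagrangian T 2 L) (hLeg : LegendreConvex L T)
    {x : ℝ → Fin m → ℝ} (hx : ContDiff ℝ 1 x) :
    IsLegendreCoeff (coeffP L x) (coeffQ L x) (coeffR L x) T where
  contP := continuousOn_pi.2 fun i => continuousOn_pi.2 fun j =>
    ((hL.partialV (k := 1) hT i).partialV (k := 0) hT j).continuousOn_comp hx.continuous
      (hx.continuous_deriv le_rfl)
  contQ := continuousOn_pi.2 fun i => continuousOn_pi.2 fun j =>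
    ((hL.partialV (k := 1) hT i).partialQ (k := 0) hT j).continuousOn_comp hx.continuous
      (hx.continuous_deriv le_rfl)
  contR := continuousOn_pi.2 fun i => continuousOn_pi.2 fun j =>
    ((hL.partialQ (k := 1) hT i).partialQ (k := 0) hT j).continuousOn_comp hx.continuous
      (hx.continuous_deriv le_rfl)
  symmP t ht := Matrix.ext fun _ _ => fderiv_fderiv_apply_comm (hL.contDiff_v ht (x t)) _ _ _
  symmR t ht := Matrix.ext fun _ _ => fderiv_fderiv_apply_comm (hL.contDiff_q ht (deriv x t)) _ _ _
  posP t ht w hw := hLeg t ht _ _ w hw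

lemma IsLegendreCoeff.mono {P Q R : ℝ → Matrix (Fin m) (Fin m) ℝ} {a b : ℝ}
    (h : IsLegendreCoeff P Q R b) (hab : a ≤ b) : IsLegendreCoeff P Q R a :=
  have hs : Icc 0 a ⊆ Icc 0 b := Icc_subset_Icc le_rfl hab
  ⟨h.contP.mono hs, h.contQ.mono hs, h.contR.mono hs, fun t ht => h.symmP t (hs ht),
    fun t ht => h.symmR t (hs ht), fun t ht => h.posP t (hs ht)⟩

lemma fderiv_comp_mulVec_single {f : (Fin m → ℝ) → ℝ} (A : Matrix (Fin m) (Fin m) ℝ)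
    (v : Fin m → ℝ) (hf : DifferentiableAt ℝ f (A.mulVec v)) (i : Fin m) :
    fderiv ℝ (fun y => f (A.mulVec y)) v (Pi.single i 1) =
      ∑ k, A k i * fderiv ℝ f (A.mulVec v) (Pi.single k 1) := by
  have h1 : HasFDerivAt (fun y => A.mulVec y)
      (LinearMap.toContinuousLinearMap (Matrix.mulVecLin A)) v :=
    (LinearMap.toContinuousLinearMap (Matrix.mulVecLin A)).hasFDerivAt
  have h2 := (hf.hasFDerivAt.comp v h1).fderiv
  have h3 : A.mulVec (Pi.single i 1) = ∑ k, A k i • (Pi.single k 1 : Fin m → ℝ) := by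
    ext l; simp [Finset.sum_apply, Pi.single_apply]
  have h4 := congrArg (fun ℓ : (Fin m → ℝ) →L[ℝ] ℝ => ℓ (Pi.single i 1)) h2
  simp only [ContinuousLinearMap.comp_apply, LinearMap.coe_toContinuousLinearMap',
    Matrix.mulVecLin_apply] at h4
  rw [h3, map_sum] at h4
  simp only [map_smul, smul_eq_mul] at h4
  exact h4

lemma fderiv_sum_comp_mulVec_single {f : Fin m → (Fin m → ℝ) → ℝ} (c : Fin m → ℝ)
    (A : Matrix (Fin m) (Fin m) ℝ) (v : Fin m → ℝ) (hf : ∀ k, Differentiable ℝ (f k)) (j : Fin m) :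
    fderiv ℝ (fun y => ∑ k, c k * f k (A.mulVec y)) v (Pi.single j 1) =
      ∑ k, c k * ∑ l, A l j * fderiv ℝ (f k) (A.mulVec v) (Pi.single l 1) := by
  have hA : ∀ k, DifferentiableAt ℝ (fun y => f k (A.mulVec y)) v := fun k =>
    ((hf k) _).comp v (LinearMap.toContinuousLinearMap (Matrix.mulVecLin A)).differentiableAt
  rw [fderiv_fun_sum fun k _ => (hA k).const_mul (c k)]
  rw [sum_apply]
  refine Finset.sum_congr rfl fun k _ => ?_
  rw [fderiv_const_mul (hA k), smul_apply, smul_eq_mul,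
    fderiv_comp_mulVec_single A v ((hf k) _)]

variable {t s : ℝ} {A K : Matrix (Fin m) (Fin m) ℝ}

lemma partialV_eq_of_invariant (hL : IsSmoothLagrangian T 2 L) (hs : s ∈ Icc 0 T)
    (h : ∀ q v, L t q v = L s (K.mulVec q) (A.mulVec v)) (q v : Fin m → ℝ) (i : Fin m) :
    partialV L t q v i = ∑ k, A k i * partialV L s (K.mulVec q) (A.mulVec v) k := by
  simp only [partialV, h]
  exact fderiv_comp_mulVec_single (f := fun y => L s (K.mulVec q) y) A v
    ((hL.contDiff_v hs _).differentiable two_ne_zero _) i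

lemma partialQ_eq_of_invariant (hL : IsSmoothLagrangian T 2 L) (hs : s ∈ Icc 0 T)
    (h : ∀ q v, L t q v = L s (K.mulVec q) (A.mulVec v)) (q v : Fin m → ℝ) (i : Fin m) :
    partialQ L t q v i = ∑ k, K k i * partialQ L s (K.mulVec q) (A.mulVec v) k := by
  simp only [partialQ, h]
  exact fderiv_comp_mulVec_single (f := fun y => L s y (A.mulVec v)) K q
    ((hL.contDiff_q hs _).differentiable two_ne_zero _) i

lemma sum_mul_sum_eq_transpose_mul_mul (A H K : Matrix (Fin m) (Fin m) ℝ) (i j : Fin m) :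
    ∑ k, A k i * ∑ l, K l j * H k l = (A.transpose * H * K) i j := by
  rw [Matrix.mul_assoc, Matrix.mul_apply]
  simp only [Matrix.mul_apply, Matrix.transpose_apply]
  exact Finset.sum_congr rfl fun k _ => by
    congr 1; exact Finset.sum_congr rfl fun l _ => mul_comm _ _

/-- Chain rule in the space variables at fixed times. Only the image time `s` must lie in `[0,T]`;
the invariance transfers regularity to time `t`. -/
lemma hessVV_eq_of_invariant (hT : 0 < T) (hL : IsSmoothLagrangian T 2 L) (hs : s ∈ Icc 0 T)
    (h : ∀ q v, L t q v = L s (K.mulVec q) (A.mulVec v)) (q v : Fin m → ℝ) :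
    hessVV L t q v = A.transpose * hessVV L s (K.mulVec q) (A.mulVec v) * A := by
  ext i j
  rw [← sum_mul_sum_eq_transpose_mul_mul]
  simp only [hessVV, Matrix.of_apply, partialV_eq_of_invariant hL hs h]
  exact fderiv_sum_comp_mulVec_single (f := fun k y => partialV L s (K.mulVec q) y k) _ _ _
    (fun k => ((hL.partialV (k := 1) hT k).contDiff_v hs _).differentiable one_ne_zero) j

lemma hessVQ_eq_of_invariant (hT : 0 < T) (hL : IsSmoothLagrangian T 2 L) (hs : s ∈ Icc 0 T)
    (h : ∀ q v, L t q v = L s (K.mulVec q) (A.mulVec v)) (q v : Fin m → ℝ) :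
    hessVQ L t q v = A.transpose * hessVQ L s (K.mulVec q) (A.mulVec v) * K := by
  ext i j
  rw [← sum_mul_sum_eq_transpose_mul_mul]
  simp only [hessVQ, Matrix.of_apply, partialV_eq_of_invariant hL hs h]
  exact fderiv_sum_comp_mulVec_single (f := fun k y => partialV L s y (A.mulVec v) k) _ _ _
    (fun k => ((hL.partialV (k := 1) hT k).contDiff_q hs _).differentiable one_ne_zero) j

lemma hessQQ_eq_of_invariant (hT : 0 < T) (hL : IsSmoothLagrangian T 2 L) (hs : s ∈ Icc 0 T)
    (h : ∀ q v, L t q v = L s (K.mulVec q) (A.mulVec v)) (q v : Fin m → ℝ) :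
    hessQQ L t q v = K.transpose * hessQQ L s (K.mulVec q) (A.mulVec v) * K := by
  ext i j
  rw [← sum_mul_sum_eq_transpose_mul_mul]
  simp only [hessQQ, Matrix.of_apply, partialQ_eq_of_invariant hL hs h]
  exact fderiv_sum_comp_mulVec_single (f := fun k y => partialQ L s y (A.mulVec v) k) _ _ _
    (fun k => ((hL.partialQ (k := 1) hT k).contDiff_q hs _).differentiable one_ne_zero) j

/-- The affine map `t ↦ σ t + c` together with the orthogonal matrix `K` leaves the Lagrangian `L`
and the loop `x` invariant. -/
structure IsLagrangianSymmetry (L : ℝ → (Fin m → ℝ) → (Fin m → ℝ) → ℝ) (x : ℝ → Fin m → ℝ)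
    (σ c : ℝ) (K : Matrix (Fin m) (Fin m) ℝ) : Prop where
  sq : σ * σ = 1
  orth : K * K.transpose = 1
  invL : ∀ t q v, L t q v = L (σ * t + c) (K.mulVec q) ((σ • K).mulVec v)
  invx : ∀ t, x (σ * t + c) = K.mulVec (x t)

variable {x : ℝ → Fin m → ℝ} {σ c σ' c' : ℝ} {K' : Matrix (Fin m) (Fin m) ℝ}

lemma IsLagrangianSymmetry.comp (h : IsLagrangianSymmetry L x σ c K)
    (h' : IsLagrangianSymmetry L x σ' c' K') :
    IsLagrangianSymmetry L x (σ' * σ) (σ' * c + c') (K' * K) where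
  sq := by rw [mul_mul_mul_comm, h.sq, h'.sq, one_mul]
  orth := by
    rw [Matrix.transpose_mul, Matrix.mul_assoc, ← Matrix.mul_assoc K, h.orth, Matrix.one_mul, h'.orth]
  invL t q v := by
    rw [h.invL, h'.invL, Matrix.mulVec_mulVec, Matrix.mulVec_mulVec, smul_mul_smul_comm]
    congr 1; ring
  invx t := by
    rw [← Matrix.mulVec_mulVec, ← h.invx, ← h'.invx]
    congr 1; ring

lemma IsLagrangianSymmetry.one : IsLagrangianSymmetry L x 1 0 1 where
  sq := one_mul 1
  orth := by simp
  invL t q v := by simp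
  invx t := by simp

lemma IsLagrangianSymmetry.pow (h : IsLagrangianSymmetry L x 1 c K) (i : ℕ) :
    IsLagrangianSymmetry L x 1 (i * c) (K ^ i) := by
  induction i with
  | zero => simpa using IsLagrangianSymmetry.one
  | succ i ih =>
    have := ih.comp h
    rw [one_mul, one_mul, ← pow_succ'] at this
    convert this using 1
    push_cast; ring

lemma IsLagrangianSymmetry.deriv_eq (h : IsLagrangianSymmetry L x σ c K) (hx : ContDiff ℝ 1 x)
    (t : ℝ) : deriv x (σ * t + c) = (σ • K).mulVec (deriv x t) := by
  have hd : ∀ t, HasDerivAt x (deriv x t) t := fun t =>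
    (hx.differentiable one_ne_zero t).hasDerivAt
  have h1 : HasDerivAt (fun t => x (σ * t + c)) (σ • deriv x (σ * t + c)) t := by
    have := HasDerivAt.scomp t (hd (σ * t + c)) (((hasDerivAt_id t).const_mul σ).add_const c)
    rw [mul_one] at this
    exact this
  have h2 : HasDerivAt (fun t => K.mulVec (x t)) (K.mulVec (deriv x t)) t :=
    (LinearMap.toContinuousLinearMap (Matrix.mulVecLin K)).hasFDerivAt.comp_hasDerivAt t (hd t)
  rw [funext h.invx] at h1
  rw [Matrix.smul_mulVec, ← h1.unique h2, smul_smul, h.sq, one_smul]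

/-- Orthogonality turns congruence by `K` into intertwining. Each velocity derivative contributes a
factor `σ`, so `P` gets `σ² = 1`, `Q` gets `σ`, and `R` none. -/
lemma IsLagrangianSymmetry.coeff_eq (h : IsLagrangianSymmetry L x σ c K) (hT : 0 < T)
    (hL : IsSmoothLagrangian T 2 L) (hx : ContDiff ℝ 1 x) (hs : σ * t + c ∈ Icc 0 T) :
    K * coeffP L x t = coeffP L x (σ * t + c) * K ∧
    K * coeffQ L x t = σ • (coeffQ L x (σ * t + c) * K) ∧
    K * (coeffQ L x t).transpose = σ • ((coeffQ L x (σ * t + c)).transpose * K) ∧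
    K * coeffR L x t = coeffR L x (σ * t + c) * K := by
  have hP := hessVV_eq_of_invariant hT hL hs (h.invL t) (x t) (deriv x t)
  have hQ := hessVQ_eq_of_invariant hT hL hs (h.invL t) (x t) (deriv x t)
  have hR := hessQQ_eq_of_invariant hT hL hs (h.invL t) (x t) (deriv x t)
  rw [← h.invx, ← h.deriv_eq hx] at hP hQ hR
  simp only [coeffP, coeffQ, coeffR, hP, hQ, hR, Matrix.transpose_mul, Matrix.transpose_smul,
    Matrix.transpose_transpose, Matrix.smul_mul, Matrix.mul_smul, smul_smul, h.sq, one_smul,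
    ← Matrix.mul_assoc, h.orth, Matrix.one_mul, and_self]

end Coefficients

/-! ### Transport of solutions by symmetries and monotonicity of the boundary term. -/

section Hyperbolic

variable {m : ℕ} {T : ℝ}

lemma cMat_mul {ι : Type*} [Fintype ι] (A B : Matrix ι ι ℝ) : cMat (A * B) = cMat A * cMat B :=
  Matrix.map_mul (f := Complex.ofRealHom)

lemma cMat_one {ι : Type*} [DecidableEq ι] : cMat (1 : Matrix ι ι ℝ) = 1 := by
  simp [cMat]

lemma cMat_smul_mulVec (r : ℝ) (A : Matrix (Fin m) (Fin m) ℝ) (v : Fin m → ℂ) :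
    (cMat (r • A)).mulVec v = r • (cMat A).mulVec v := by
  have : cMat (r • A) = (r : ℂ) • cMat A := by ext i j; simp [cMat]
  rw [this, Matrix.smul_mulVec, Complex.coe_smul]

lemma cMat_mulVec_real_smul (r : ℝ) (A : Matrix (Fin m) (Fin m) ℝ) (v : Fin m → ℂ) :
    (cMat A).mulVec (r • v) = r • (cMat A).mulVec v := by
  rw [← Complex.coe_smul, Matrix.mulVec_smul, Complex.coe_smul]

lemma cMat_mulVec_smul_comm {A B K : Matrix (Fin m) (Fin m) ℝ} {r : ℝ} (h : K * A = r • (B * K))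
    (v : Fin m → ℂ) :
    (cMat K).mulVec ((cMat A).mulVec v) = r • (cMat B).mulVec ((cMat K).mulVec v) := by
  rw [Matrix.mulVec_mulVec, ← cMat_mul, h, cMat_smul_mulVec, cMat_mul, Matrix.mulVec_mulVec]

lemma cMat_mulVec_comm {A B K : Matrix (Fin m) (Fin m) ℝ} (h : K * A = B * K) (v : Fin m → ℂ) :
    (cMat K).mulVec ((cMat A).mulVec v) = (cMat B).mulVec ((cMat K).mulVec v) := by
  simpa using cMat_mulVec_smul_comm (r := 1) (by rwa [one_smul]) v

lemma cMat_mulVec_dotProduct_star_of_orth {K : Matrix (Fin m) (Fin m) ℝ}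
    (hK : K * K.transpose = 1) (v w : Fin m → ℂ) :
    (cMat K).mulVec v ⬝ᵥ star ((cMat K).mulVec w) = v ⬝ᵥ star w := by
  rw [cMat_mulVec_dotProduct_star, Matrix.mulVec_mulVec, ← cMat_mul, mul_eq_one_comm.1 hK, cMat_one,
    Matrix.one_mulVec]

lemma HasDerivWithinAt.cMat_mulVec {u : ℝ → Fin m → ℂ} {u' : Fin m → ℂ} {s : Set ℝ} {t : ℝ}
    (K : Matrix (Fin m) (Fin m) ℝ) (h : HasDerivWithinAt u u' s t) :
    HasDerivWithinAt (fun t => (cMat K).mulVec (u t)) ((cMat K).mulVec u') s t :=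
  (LinearMap.toContinuousLinearMap
    ((Matrix.mulVecLin (cMat K)).restrictScalars ℝ)).hasFDerivAt.comp_hasDerivWithinAt t h

variable {L : ℝ → (Fin m → ℝ) → (Fin m → ℝ) → ℝ} {x : ℝ → Fin m → ℝ} {σ c a : ℝ}
  {K : Matrix (Fin m) (Fin m) ℝ} {u u₁ p : ℝ → Fin m → ℂ}

/-- The symmetry carries solutions to solutions. -/
lemma IsSturmSolution.transport (h : IsLagrangianSymmetry L x σ c K) (hT : 0 < T)
    (hL : IsSmoothLagrangian T 2 L) (hx : ContDiff ℝ 1 x) (haT : a ≤ T)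
    (hmaps : ∀ s ∈ Icc 0 a, σ * (s - c) ∈ Icc 0 T)
    (hu : IsSturmSolution (coeffP L x) (coeffQ L x) (coeffR L x) (Icc 0 T) u u₁ p) :
    IsSturmSolution (coeffP L x) (coeffQ L x) (coeffR L x) (Icc 0 a)
      (fun s => (cMat K).mulVec (u (σ * (s - c))))
      (fun s => σ • (cMat K).mulVec (u₁ (σ * (s - c))))
      (fun s => σ • (cMat K).mulVec (p (σ * (s - c)))) := by
  -- As `σ² = 1`, the map `s ↦ σ (s - c)` inverts `t ↦ σ t + c`.
  have hτ : ∀ s, σ * (σ * (s - c)) + c = s := fun s => by rw [← mul_assoc, h.sq]; ring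
  have hd : ∀ s, HasDerivWithinAt (fun s => σ * (s - c)) σ (Icc 0 a) s := fun s => by
    simpa using (((hasDerivAt_id s).sub_const c).const_mul σ).hasDerivWithinAt
  have hcoef : ∀ s ∈ Icc 0 a, _ := fun s hs =>
    h.coeff_eq (t := σ * (s - c)) hT hL hx (by rw [hτ]; exact ⟨hs.1, hs.2.trans haT⟩)
  simp only [hτ] at hcoef
  refine ⟨fun s hs => ?_, fun s hs => ?_, fun s hs => ?_⟩
  · obtain ⟨hP, hQ, -, -⟩ := hcoef s hs
    rw [← hu.momentum _ (hmaps s hs), Matrix.mulVec_add, cMat_mulVec_comm hP,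
      cMat_mulVec_smul_comm hQ, smul_add, smul_smul, h.sq, one_smul, cMat_mulVec_real_smul]
  · have := HasDerivWithinAt.scomp s (hu.deriv_u _ (hmaps s hs)) (hd s) hmaps
    have := this.cMat_mulVec K
    rwa [cMat_mulVec_real_smul] at this
  · obtain ⟨-, -, hQ, hR⟩ := hcoef s hs
    have := HasDerivWithinAt.scomp s (hu.deriv_p _ (hmaps s hs)) (hd s) hmaps
    have := (this.cMat_mulVec K).fun_const_smul σ
    rw [cMat_mulVec_real_smul, smul_smul, h.sq, one_smul, Matrix.mulVec_add,
      cMat_mulVec_smul_comm hQ, cMat_mulVec_comm hR, ← cMat_mulVec_real_smul] at this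
    exact this

/-- The boundary term `P u' · ū` of a solution does not decrease along a symmetric copy of
`[0,a]`. -/
lemma IsSturmSolution.boundary_mono (h : IsLagrangianSymmetry L x σ c K) (hT : 0 < T)
    (hL : IsSmoothLagrangian T 2 L) (hLeg : LegendreConvex L T) (hx : ContDiff ℝ 1 x)
    (ha : 0 < a) (haT : a ≤ T) (hmaps : ∀ s ∈ Icc 0 a, σ * (s - c) ∈ Icc 0 T)
    (hpos : SturmPosDefNeumann (coeffP L x) (coeffQ L x) (coeffR L x) a)
    (hu : IsSturmSolution (coeffP L x) (coeffQ L x) (coeffR L x) (Icc 0 T) u u₁ p) :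
    0 ≤ σ * (((cMat (coeffP L x (σ * (a - c)))).mulVec (u₁ (σ * (a - c))) ⬝ᵥ
          star (u (σ * (a - c)))).re -
        ((cMat (coeffP L x (σ * (0 - c)))).mulVec (u₁ (σ * (0 - c))) ⬝ᵥ
          star (u (σ * (0 - c)))).re) := by
  have hcoef := (isLegendreCoeff_coeff hT hL hLeg hx).mono haT
  have hv := hu.transport h hT hL hx haT hmaps
  have h1 := (hv.boundary_nonneg ha hcoef hpos).1
  rw [hv.sturmForm_eq ha.le hcoef (hv.isC1Pair hcoef)] at h1
  have hτ : ∀ s, σ * (σ * (s - c)) + c = s := fun s => by rw [← mul_assoc, h.sq]; ring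
  -- `K` commutes past the coefficient and drops out of the Hermitian product, leaving one `σ` from
  -- the time derivative. For a reflection this sign cancels the exchange of the end points.
  have e : ∀ s ∈ Icc 0 a, (cMat (coeffP L x s)).mulVec (σ • (cMat K).mulVec (u₁ (σ * (s - c)))) ⬝ᵥ
      star ((cMat K).mulVec (u (σ * (s - c)))) =
      σ * ((cMat (coeffP L x (σ * (s - c)))).mulVec (u₁ (σ * (s - c))) ⬝ᵥ
        star (u (σ * (s - c)))) := fun s hs => by
    obtain ⟨hP, -⟩ := h.coeff_eq (t := σ * (s - c)) hT hL hx
      (by rw [hτ]; exact ⟨hs.1, hs.2.trans haT⟩)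
    rw [hτ] at hP
    rw [cMat_mulVec_real_smul, ← cMat_mulVec_comm hP, ← Complex.coe_smul, smul_dotProduct, smul_eq_mul,
      cMat_mulVec_dotProduct_star_of_orth h.orth]
  rw [e a ⟨ha.le, le_rfl⟩, e 0 ⟨le_rfl, ha.le⟩, Complex.sub_re, Complex.re_ofReal_mul,
    Complex.re_ofReal_mul, ← mul_sub] at h1
  exact h1

end Hyperbolic

/-! ### From the Hamiltonian system to the Sturm equation. -/

section Monodromy

variable {m : ℕ} {T : ℝ}

/-- The Legendre transform in coordinates `z = (p, q)`: `q' = P⁻¹ (p - Q q)` and `p' = Qᵀ q' + R q`.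
-/
lemma cMat_stdJ_mul_hamB_mulVec (A B C : Matrix (Fin m) (Fin m) ℝ) (z : Fin m ⊕ Fin m → ℂ) :
    (cMat (stdJ m * hamB A B C)).mulVec z =
      Sum.elim ((cMat B.transpose).mulVec ((cMat A⁻¹).mulVec (z ∘ Sum.inl -
        (cMat B).mulVec (z ∘ Sum.inr))) + (cMat C).mulVec (z ∘ Sum.inr))
        ((cMat A⁻¹).mulVec (z ∘ Sum.inl - (cMat B).mulVec (z ∘ Sum.inr))) := by
  have hadd : ∀ X Y : Matrix (Fin m) (Fin m) ℝ, cMat (X + Y) = cMat X + cMat Y := fun X Y => by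
    ext i j; simp [cMat]
  have hneg : ∀ X : Matrix (Fin m) (Fin m) ℝ, cMat (-X) = -cMat X := fun X => by
    ext i j; simp [cMat]
  have hsub : ∀ X Y : Matrix (Fin m) (Fin m) ℝ, cMat (X - Y) = cMat X - cMat Y := fun X Y => by
    ext i j; simp [cMat]
  have hb : ∀ X Y Z W : Matrix (Fin m) (Fin m) ℝ, cMat (Matrix.fromBlocks X Y Z W) =
      Matrix.fromBlocks (cMat X) (cMat Y) (cMat Z) (cMat W) := fun X Y Z W =>
    Matrix.fromBlocks_map _ _ _ _ _
  rw [stdJ, hamB, Matrix.fromBlocks_multiply, hb, Matrix.fromBlocks_mulVec]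
  simp only [Matrix.zero_mul, Matrix.one_mul, Matrix.neg_mul, zero_add, add_zero, neg_neg, hneg,
    hsub, cMat_mul, Matrix.mulVec_sub, Matrix.neg_mulVec, Matrix.sub_mulVec, Matrix.mulVec_mulVec,
    Matrix.mul_assoc]
  congr 1; abel

variable {P Q R : ℝ → Matrix (Fin m) (Fin m) ℝ}
  {γ : ℝ → Matrix (Fin m ⊕ Fin m) (Fin m ⊕ Fin m) ℝ}

/-- A trajectory of the Hamiltonian system is a solution of the Sturm equation. -/
lemma IsFundamentalSolution.isSturmSolution (h : IsLegendreCoeff P Q R T)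
    (hγ : IsFundamentalSolution P Q R T γ) (z₀ : Fin m ⊕ Fin m → ℂ) :
    IsSturmSolution P Q R (Icc 0 T) (fun t => (cMat (γ t)).mulVec z₀ ∘ Sum.inr)
      (fun t => (cMat (P t)⁻¹).mulVec ((cMat (γ t)).mulVec z₀ ∘ Sum.inl -
        (cMat (Q t)).mulVec ((cMat (γ t)).mulVec z₀ ∘ Sum.inr)))
      (fun t => (cMat (γ t)).mulVec z₀ ∘ Sum.inl) := by
  have hd : ∀ t ∈ Icc 0 T, ∀ i, HasDerivWithinAt (fun t => (cMat (γ t)).mulVec z₀ i)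
      ((cMat (stdJ m * hamB (P t) (Q t) (R t))).mulVec ((cMat (γ t)).mulVec z₀) i)
      (Icc 0 T) t := fun t ht i => by
    rw [Matrix.mulVec_mulVec, ← cMat_mul]
    simp only [Matrix.mulVec, dotProduct]
    have h1 := hasDerivWithinAt_pi.1 (hγ.2 t ht) i
    refine HasDerivWithinAt.fun_sum fun j _ => HasDerivWithinAt.mul_const ?_ _
    exact (hasDerivWithinAt_pi.1 h1 j).ofReal_comp
  simp only [cMat_stdJ_mul_hamB_mulVec] at hd
  refine ⟨fun t ht => ?_, fun t ht => ?_, fun t ht => ?_⟩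
  · have hP : IsUnit (P t).det := isUnit_iff_ne_zero.2 (det_ne_zero_of_forall_pos (h.posP t ht))
    rw [Matrix.mulVec_mulVec, ← cMat_mul, Matrix.mul_nonsing_inv _ hP, cMat_one, Matrix.one_mulVec,
      sub_add_cancel]
  · exact hasDerivWithinAt_pi.2 fun i => hd t ht (Sum.inr i)
  · exact hasDerivWithinAt_pi.2 fun i => hd t ht (Sum.inl i)

lemma IsSturmSolution.mono {s s' : Set ℝ} {u u₁ p : ℝ → Fin m → ℂ}
    (hu : IsSturmSolution P Q R s u u₁ p) (hs : s' ⊆ s) : IsSturmSolution P Q R s' u u₁ p :=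
  ⟨fun t ht => hu.momentum t (hs ht), fun t ht => (hu.deriv_u t (hs ht)).mono hs,
    fun t ht => (hu.deriv_p t (hs ht)).mono hs⟩

lemma IsSturmSolution.momentum_eq_zero {a : ℝ} (ha : 0 < a) {u u₁ p : ℝ → Fin m → ℂ}
    (hu : IsSturmSolution P Q R (Icc 0 a) u u₁ p) (h0 : ∀ t ∈ Icc 0 a, u t = 0) : p 0 = 0 := by
  have z : (0:ℝ) ∈ Icc 0 a := ⟨le_rfl, ha.le⟩
  have h1 : u₁ 0 = 0 := by
    refine (uniqueDiffOn_Icc ha 0 z).eq_deriv _ (hu.deriv_u 0 z) ?_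
    exact (hasDerivWithinAt_const 0 _ (0 : Fin m → ℂ)).congr h0 (h0 0 z)
  rw [← hu.momentum 0 z, h1, h0 0 z, Matrix.mulVec_zero, Matrix.mulVec_zero, add_zero]

end Monodromy

/-! ### The hyperbolicity theorem. -/

theorem mainTheorem8 {m n : ℕ} (hn : 0 < n) {T : ℝ} (hT : 0 < T)
    (L : ℝ → (Fin m → ℝ) → (Fin m → ℝ) → ℝ)
    (hL : ContDiffOn ℝ 2 (fun p : ℝ × (Fin m → ℝ) × (Fin m → ℝ) => L p.1 p.2.1 p.2.2)
      (Icc 0 T ×ˢ univ))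
    (hLeg : LegendreConvex L T)
    (S N : Matrix (Fin m) (Fin m) ℝ)
    (hSO : S ∈ Matrix.orthogonalGroup (Fin m) ℝ) (hNO : N ∈ Matrix.orthogonalGroup (Fin m) ℝ)
    (hS : S ^ n = 1) (hN : N ^ 2 = 1) (hNS : (N * S) ^ 2 = 1)
    (hLS : ∀ (t : ℝ) (q v : Fin m → ℝ), L t q v = L (t - T / n) (S.mulVec q) (S.mulVec v))
    (hLN : ∀ (t : ℝ) (q v : Fin m → ℝ), L t q v = L (T / n - t) (N.mulVec q) (-N.mulVec v))
    (x : ℝ → Fin m → ℝ) (hx : IsCriticalLoop L T x)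
    (hxS : ∀ t : ℝ, S.mulVec (x (t + T / n)) = x t)
    (hxN : ∀ t : ℝ, N.mulVec (x (T / n - t)) = x t)
    (hpos : SturmPosDefNeumann (coeffP L x) (coeffQ L x) (coeffR L x) (T / (2 * n)))
    (γ : ℝ → Matrix (Fin m ⊕ Fin m) (Fin m ⊕ Fin m) ℝ)
    (hγ : IsFundamentalSolution (coeffP L x) (coeffQ L x) (coeffR L x) T γ) :
    IsHyperbolicMatrix (γ T) := by
  have hn' : (0:ℝ) < n := Nat.cast_pos.2 hn
  have hn1 : (1:ℝ) ≤ n := Nat.one_le_cast.2 hn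
  set a : ℝ := T / (2 * n) with ha_def
  have ha : 0 < a := by positivity
  have hTa : T = 2 * n * a := by rw [ha_def]; field_simp
  have hTn : T / n = 2 * a := by rw [ha_def]; field_simp
  have haT : a ≤ T := by rw [hTa]; nlinarith
  have hcoef := isLegendreCoeff_coeff hT hL hLeg hx.1
  -- In units of `a`, `S` acts on time as the shift by `-2a` and `N` as the reflection about `a`.
  have symS : IsLagrangianSymmetry L x 1 (-(T / n)) S :=
    { sq := one_mul 1
      orth := (Matrix.mem_orthogonalGroup_iff (Fin m) ℝ).1 hSO
      invL := fun t q v => by rw [hLS, one_mul, one_smul, sub_eq_add_neg]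
      invx := fun t => by
        have := hxS (t - T / n)
        rw [sub_add_cancel] at this
        rw [one_mul, ← sub_eq_add_neg, this] }
  have symN : IsLagrangianSymmetry L x (-1) (T / n) N :=
    { sq := by norm_num
      orth := (Matrix.mem_orthogonalGroup_iff (Fin m) ℝ).1 hNO
      invL := fun t q v => by
        rw [hLN, neg_one_smul, Matrix.neg_mulVec, neg_one_mul, neg_add_eq_sub]
      invx := fun t => by
        have := hxN (T / n - t)
        rw [sub_sub_cancel] at this
        rw [neg_one_mul, neg_add_eq_sub, this] }
  intro ω hω hev
  obtain ⟨z₀, hz₀⟩ := hev.exists_hasEigenvector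
  have hzT : (cMat (γ T)).mulVec z₀ = ω • z₀ := by
    have := hz₀.apply_eq_smul
    rwa [Matrix.toLin'_apply] at this
  have hz0 : (cMat (γ 0)).mulVec z₀ = z₀ := by rw [hγ.1, cMat_one, Matrix.one_mulVec]
  have hu := hγ.isSturmSolution hcoef z₀
  have hu0 : (fun t => (cMat (γ t)).mulVec z₀ ∘ Sum.inr) 0 = z₀ ∘ Sum.inr := by
    beta_reduce; rw [hz0]
  have hp0 : (fun t => (cMat (γ t)).mulVec z₀ ∘ Sum.inl) 0 = z₀ ∘ Sum.inl := by
    beta_reduce; rw [hz0]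
  have huT : (fun t => (cMat (γ t)).mulVec z₀ ∘ Sum.inr) T = ω • (z₀ ∘ Sum.inr) := by
    beta_reduce; rw [hzT]; rfl
  have hpT : (fun t => (cMat (γ t)).mulVec z₀ ∘ Sum.inl) T = ω • (z₀ ∘ Sum.inl) := by
    beta_reduce; rw [hzT]; rfl
  generalize (fun t => (cMat (γ t)).mulVec z₀ ∘ Sum.inr) = u at hu hu0 huT
  generalize (fun t => (cMat (γ t)).mulVec z₀ ∘ Sum.inl) = p at hu hp0 hpT
  generalize (fun t => (cMat (coeffP L x t)⁻¹).mulVec ((cMat (γ t)).mulVec z₀ ∘ Sum.inl -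
        (cMat (coeffQ L x t)).mulVec ((cMat (γ t)).mulVec z₀ ∘ Sum.inr))) = u₁ at hu
  set H : ℝ → ℝ := fun t => ((cMat (coeffP L x t)).mulVec (u₁ t) ⬝ᵥ star (u t)).re with hH
  have hstep : ∀ k : ℕ, k < 2 * n → H (k * a) ≤ H ((k + 1 : ℕ) * a) := by
    intro k hk
    obtain ⟨i, hi | hi⟩ := k.even_or_odd'
    -- For `k = 2i`, the `i`-th power of the shift carries `[ka, (k+1)a]` onto `[0,a]`, preserving
    -- orientation.
    · have hin : (i : ℝ) + 1 ≤ n := by exact_mod_cast (by lia : i + 1 ≤ n)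
      have := hu.boundary_mono (symS.pow i) hT hL hLeg hx.1 ha haT (fun s hs => by
        rw [hTn, hTa]
        have h1 := mul_le_mul_of_nonneg_right hin ha.le
        have h2 : 0 ≤ (i : ℝ) * a := by positivity
        constructor
        · linarith [hs.1]
        · linarith [hs.2]) hpos
      have e1 : 1 * (a - i * -(T / n)) = ((k + 1 : ℕ) : ℝ) * a := by
        rw [hTn, hi]; push_cast; ring
      have e2 : 1 * (0 - i * -(T / n)) = (k : ℝ) * a := by rw [hTn, hi]; push_cast; ring
      rw [e1, e2] at this
      simp only [hH]
      linarith
    -- For `k = 2i + 1`, the shifted interval is `[a, 2a]`, and the reflection folds it onto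
    -- `[0,a]`, reversing orientation.
    · have hin : (i : ℝ) + 1 ≤ n := by exact_mod_cast (by lia : i + 1 ≤ n)
      have := hu.boundary_mono (((symS.pow i).comp symN)) hT hL hLeg hx.1 ha haT (fun s hs => by
        rw [hTn, hTa]
        have h1 := mul_le_mul_of_nonneg_right hin ha.le
        have h2 : 0 ≤ (i : ℝ) * a := by positivity
        constructor
        · linarith [hs.2]
        · linarith [hs.1]) hpos
      have e1 : -1 * 1 * (a - (-1 * (i * -(T / n)) + T / n)) = (k : ℝ) * a := by
        rw [hTn, hi]; push_cast; ring
      have e2 : -1 * 1 * (0 - (-1 * (i * -(T / n)) + T / n)) = ((k + 1 : ℕ) : ℝ) * a := by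
        rw [hTn, hi]; push_cast; ring
      rw [e1, e2] at this
      simp only [hH]
      linarith
  have hchain : ∀ k : ℕ, 1 ≤ k → k ≤ 2 * n → H ((1 : ℕ) * a) ≤ H (k * a) := by
    intro k hk
    induction k, hk using Nat.le_induction with
    | base => exact fun _ => le_rfl
    | succ k _ ih => exact fun h => (ih (by lia)).trans (hstep k (by lia))
  have hends : H T = H 0 := by
    -- The `n`-th power of the shift takes time `T` to `0` with matrix `S^n = 1`.
    have hQT : coeffQ L x T = coeffQ L x 0 := by
      have e : 1 * T + n * -(T / n) = 0 := by field_simp; ring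
      have := ((symS.pow n).coeff_eq (t := T) hT hL hx.1 (by rw [e]; exact ⟨le_rfl, hT.le⟩)).2.1
      rw [e, hS] at this
      simpa using this
    have e : ∀ t ∈ Icc 0 T, (cMat (coeffP L x t)).mulVec (u₁ t) =
        p t - (cMat (coeffQ L x t)).mulVec (u t) := fun t ht => by
      rw [← hu.momentum t ht, add_sub_cancel_right]
    have hωω : ω * star ω = 1 := by
      rw [RCLike.star_def, Complex.mul_conj, Complex.normSq_eq_norm_sq, hω]; simp
    simp only [hH]
    rw [e T ⟨hT.le, le_rfl⟩, e 0 ⟨le_rfl, hT.le⟩, hQT, hu0, hp0, huT, hpT, Matrix.mulVec_smul,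
      ← smul_sub, star_smul, smul_dotProduct, dotProduct_smul, smul_smul, hωω, one_smul]
  have hua := hu.mono (Icc_subset_Icc le_rfl haT)
  have hca := hcoef.mono haT
  -- The form at `u` on `[0,a]` is `H(a) - H(0)`, which is nonnegative, while `H(a) ≤ H(T) = H(0)`.
  have hza : (sturmForm (coeffP L x) (coeffQ L x) (coeffR L x) a u u₁ u u₁).re = 0 := by
    refine le_antisymm ?_ (hua.boundary_nonneg ha hca hpos).1
    rw [hua.sturmForm_eq ha.le hca (hua.isC1Pair hca), Complex.sub_re]
    have h1 := hchain (2 * n) (by lia) le_rfl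
    have e : ((2 * n : ℕ) : ℝ) * a = T := by rw [hTa]; push_cast; ring
    rw [e, hends, Nat.cast_one, one_mul] at h1
    simp only [hH] at h1
    linarith
  have hu_zero := hua.eq_zero_of_boundary_eq_zero ha hca hpos hza
  have hp_zero := hua.momentum_eq_zero ha hu_zero
  refine hz₀.2 (funext fun i => ?_)
  rcases i with i | i
  · exact congrFun (hp0.symm.trans hp_zero) i
  · exact congrFun (hu0.symm.trans (hu_zero 0 ⟨le_rfl, ha.le⟩)) i
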